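/- Let $\mathcal N=\{u_1,\dots,u_n\}$ be a finite ground set whose elements arrive one by one in the order $u_1,\dots,u_n$, and let $f:2^{\mathcal N}\to\mathbb R_{\ge 0}$ be submodular. Let $p\ge 1$ be an integer and let $(\mathcal N_1,\mathcal I_1),\dots,(\mathcal N_m,\mathcal I_m)$ be matroids with $\mathcal N_\ell\subseteq\mathcal N$ such that every element of $\mathcal N$ belongs to at most $p$ of the sets $\mathcal N_\ell$. They define the $p$-matchoid $(\mathcal N,\mathcal I)$ in which $T\in\mathcal I$ if and only if $T\cap\mathcal N_\ell\in\mathcal I_\ell$ for all $\ell$. Let $k$ be the largest size of a set in $\mathcal I$, and let $\mathrm{OPT}\in\mathcal I$ maximize $f$ over $\mathcal I$. Write $f(u\mid S)=f(S\cup\{u\})-f(S)$, $f(u_i:S)=f(u_i\mid S\cap\{u_1,\dots,u_{i-1}\})$ and $f(U:S)=\sum_{x\in U}f(x:S)$. The function $f$ is given by a value oracle, and each matroid by an oracle that tells whether $T\cap\mathcal N_\ell\in\mathcal I_\ell$ for a queried set $T$. For $c>0$ and $q=((1+c)p+1)^{-1}$, the algorithm Sample-Streaming starts with $S_0=\varnothing$.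 When $u_i$ arrives, then independently with probability $1-q$ it sets $S_i=S_{i-1}$. Otherwise it computes a set $U_i$ as follows: starting from $U_i=\varnothing$, for every $\ell=1,\dots,m$ with $(S_{i-1}\cup\{u_i\})\cap\mathcal N_\ell\notin\mathcal I_\ell$ it forms $X_\ell=\{x\in S_{i-1}:((S_{i-1}\setminus\{x\})\cup\{u_i\})\cap\mathcal N_\ell\in\mathcal I_\ell\}$ and adds to $U_i$ an element $x_\ell\in X_\ell$ that minimizes $f(x:S_{i-1})$, with ties broken by an arbitrary deterministic rule that depends only on $S_{i-1}$, $u_i$ and $\ell$. It then sets $S_i=(S_{i-1}\setminus U_i)\cup\{u_i\}$ if $f(u_i\mid S_{i-1})\ge(1+c)\,f(U_i:S_{i-1})$, and $S_i=S_{i-1}$ otherwise. (If some required $X_\ell$ is empty, which happens only if $\{u_i\}\notin\mathcal I$, then $u_i$ is rejected.) It returns $S_n$. Then the following hold. 1. If $f$ is monotone and $c=1$, then $\mathbb E[f(S_n)]\ge \dfrac{f(\mathrm{OPT})}{4p}$. 2. If $c=\sqrt{1+1/p}$ (with $f$ not necessarily monotone), then $\mathbb E[f(S_n)]\ge \dfrac{f(\mathrm{OPT})}{2p+2\sqrt{p(p+1)}+1}$.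 3. For every $c>0$ the returned set is always in $\mathcal I$. Moreover, there is a universal constant $C$ such that, if $k\ge 1$, the algorithm never uses more than $Ck$ memory (counted in stored elements and numbers), and, if $k\ge1$ and $m\ge1$, the expected number of queries to the value and independence oracles during the processing of any single arriving element is at most $Ckm/p$. -/

import Mathlib

universe u

namespace SampleStreaming

noncomputable section

/-! ### Submodular functions and matchoids -/

/-- Submodularity of a set function. -/
def Submodular {N : Type u} [DecidableEq N] (f : Finset N → ℝ) : Prop :=
  ∀ A B : Finset N, f (A ∪ B) + f (A ∩ B) ≤ f A + f B

/-- The matroids `(N_ℓ, I_ℓ)`, where `N_ℓ = (Ms ℓ).E` is a subset of `N`, define a `p`-matchoid: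
every element of `N` belongs to at most `p` of the ground sets `N_ℓ`. -/
def IsMatchoid {N : Type u} {m : ℕ} (p : ℕ) (Ms : Fin m → Matroid N) : Prop :=
  ∀ x : N, {ℓ : Fin m | x ∈ (Ms ℓ).E}.ncard ≤ p

/-- Independent sets of the matchoid: `T ∩ N_ℓ ∈ I_ℓ` for every `ℓ`. -/
def Feasible {N : Type u} {m : ℕ} (Ms : Fin m → Matroid N) (T : Finset N) : Prop :=
  ∀ ℓ : Fin m, (Ms ℓ).Indep ((T : Set N) ∩ (Ms ℓ).E)

open Classical in
/-- The number `k`: the largest size of an independent set of the matchoid. -/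
def matchoidRank {N : Type u} [Fintype N] {m : ℕ} (Ms : Fin m → Matroid N) : ℕ :=
  ((Finset.univ : Finset (Finset N)).filter (Feasible Ms)).sup Finset.card

/-- `OPT` is an independent set of maximum value. -/
def IsOptimal {N : Type u} {m : ℕ} (f : Finset N → ℝ) (Ms : Fin m → Matroid N)
    (OPT : Finset N) : Prop :=
  Feasible Ms OPT ∧ ∀ T : Finset N, Feasible Ms T → f T ≤ f OPT

/-! ### Oracle programs with an explicit memory

A program has no access to `f` or to the matroids except through its query commands, and all data
that is passed from one command to the next lives in the memory.  Executing a program yields the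
final memory, the number of oracle queries, and the peak memory usage. -/

/-- The working memory while one arriving element is processed. -/
structure Memory (N : Type u) where
  /-- the arriving element -/
  u : N
  /-- the current solution, in order of arrival -/
  S : List N
  /-- the set `U` of elements to be exchanged -/
  U : List N
  /-- the set `X_ℓ` of the matroid under consideration -/
  X : List N
  /-- the best element of `X_ℓ` found so far, with its value -/
  best : Option (N × ℝ)
  /-- the value `f(x : S)` of the element under consideration -/
  val : ℝ
  /-- the marginal contribution `f(u ∣ S)` -/
  gain : ℝ
  /-- the value `f(U : S)` -/
  loss : ℝ
  /-- the last answer of an independence oracle -/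
  ans : Bool
  /-- `false` once some `X_ℓ` was empty although `X_ℓ` had to provide an element -/
  valid : Bool

/-- The memory used, in stored elements and numbers: the stored lists, and nine scalar cells. -/
def Memory.size {N : Type u} (M : Memory N) : ℕ :=
  M.S.length + M.U.length + M.X.length + 9

/-- Programs with access to a value oracle and to `m` independence oracles. -/
inductive Command (N : Type u) (m : ℕ) : Type u
  /-- local computation on the memory, without oracle access -/
  | update (g : Memory N → Memory N) : Command N m
  /-- one query to the value oracle -/
  | value (A : Memory N → Finset N) (g : ℝ → Memory N → Memory N) : Command N m
  /-- one query to the `ℓ`-th independence oracle -/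
  | indep (ℓ : Fin m) (A : Memory N → Finset N) (g : Bool → Memory N → Memory N) : Command N m
  /-- sequential composition -/
  | seq (a b : Command N m) : Command N m
  /-- execute `a` only if the condition `b` fails -/
  | unlessDo (b : Memory N → Bool) (a : Command N m) : Command N m
  /-- for `ℓ = 1` to `m` do -/
  | forMatroid (body : Fin m → Command N m) : Command N m
  /-- for every `x` in the list `L` do -/
  | forElem (L : Memory N → List N) (body : N → Command N m) : Command N m

/-- The result of executing a program. -/
structure Outcome (N : Type u) where
  /-- the final memory -/
  mem : Memory N
  /-- the number of queries to the value oracle and to the independence oracles -/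
  queries : ℕ
  /-- the peak memory usage -/
  peak : ℕ

/-- The outcome of doing nothing. -/
def Outcome.idle {N : Type u} (M : Memory N) : Outcome N := ⟨M, 0, M.size⟩

/-- Continue an execution: queries add up, and the peak is the maximum of the peaks. -/
def Outcome.andThen {N : Type u} (r : Outcome N) (h : Memory N → Outcome N) : Outcome N :=
  ⟨(h r.mem).mem, r.queries + (h r.mem).queries, max r.peak (h r.mem).peak⟩

/-- Execution of a program with value oracle `f` and independence oracles `I`.  During a query the
queried set occupies memory too, and a loop additionally occupies the memory of its counter or of a
copy of the list that it runs through. -/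
def Command.exec {N : Type u} {m : ℕ} (f : Finset N → ℝ) (I : Fin m → Finset N → Bool) :
    Command N m → Memory N → Outcome N
  | .update g, M => ⟨g M, 0, max M.size (g M).size⟩
  | .value A g, M =>
      ⟨g (f (A M)) M, 1, max (M.size + (A M).card) (g (f (A M)) M).size⟩
  | .indep ℓ A g, M =>
      ⟨g (I ℓ (A M)) M, 1, max (M.size + (A M).card) (g (I ℓ (A M)) M).size⟩
  | .seq a b, M => (a.exec f I M).andThen (b.exec f I)
  | .unlessDo b a, M => if b M then Outcome.idle M else a.exec f I M
  | .forMatroid body, M =>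
      let r := (List.finRange m).foldl
        (fun r ℓ => r.andThen ((body ℓ).exec f I)) (Outcome.idle M)
      { r with peak := r.peak + 1 }
  | .forElem L body, M =>
      let r := (L M).foldl (fun r x => r.andThen ((body x).exec f I)) (Outcome.idle M)
      { r with peak := r.peak + (L M).length }

/-! ### The algorithm -/

/-- The elements of the list `S` that come before `x`.  As solutions are stored in order of
arrival, this is `S ∩ {u_1, …, u_{i-1}}` for `x = u_i ∈ S`, so that
`f(x : S) = f(x ∣ S ∩ {u_1, …, u_{i-1}}) = f(before S x + x) - f(before S x)`. -/
def before {N : Type u} [DecidableEq N] (S : List N) (x : N) : Finset N :=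
  (S.takeWhile (fun y => decide (y ≠ x))).toFinset

/-- A deterministic tie-breaking rule that depends only on the current solution `S` and on the
arriving element `u` (and on `ℓ`): `tie ℓ S u x y` says whether `x` replaces the best element `y`
found so far when both have the same value.  No law is imposed; every way of choosing one of the
minimizers as a function of `ℓ, S, u` arises in this way (let only the chosen one ever replace). -/
abbrev TieRule (N : Type u) (m : ℕ) : Type u :=
  Fin m → Finset N → N → N → N → Bool

/-- Compare `x`, whose value is `M.val`, with the best element so far. -/
def challenge {N : Type u} [DecidableEq N] {m : ℕ} (tie : TieRule N m) (ℓ : Fin m) (x : N)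
    (M : Memory N) : Memory N :=
  match M.best with
  | none => { M with best := some (x, M.val) }
  | some (y, w) =>
      if M.val < w ∨ (M.val = w ∧ tie ℓ M.S.toFinset M.u x y = true) then
        { M with best := some (x, M.val) }
      else M

/-- Add the best element of `X_ℓ` to the set `U`; if there is none, `u` cannot be exchanged. -/
def addBest {N : Type u} [DecidableEq N] (M : Memory N) : Memory N :=
  match M.best with
  | none => { M with valid := false }
  | some (x, _) => { M with U := if x ∈ M.U then M.U else M.U ++ [x] }

/-- One iteration of the loop of Exchange-Candidate: if `(S + u) ∩ N_ℓ ∉ I_ℓ`, compute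
`X_ℓ = {x ∈ S ∣ (S - x + u) ∩ N_ℓ ∈ I_ℓ}`, and add an element of `X_ℓ` that minimizes `f(x : S)`
to `U`. -/
def exchangeIn {N : Type u} [DecidableEq N] {m : ℕ} (tie : TieRule N m) (ℓ : Fin m) :
    Command N m :=
  .seq
    (.indep ℓ (fun M => insert M.u M.S.toFinset)
      (fun b M => { M with ans := b, X := [], best := none }))
    (.unlessDo (fun M => M.ans)
      (.seq
        (.forElem (fun M => M.S) (fun x =>
          .indep ℓ (fun M => insert M.u (M.S.toFinset.erase x))
            (fun b M => if b then { M with X := M.X ++ [x] } else M)))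
        (.seq
          (.forElem (fun M => M.X) (fun x =>
            .seq (.value (fun M => insert x (before M.S x)) (fun v M => { M with val := v }))
              (.seq (.value (fun M => before M.S x) (fun v M => { M with val := M.val - v }))
                (.update (challenge tie ℓ x)))))
          (.update addBest))))

/-- Exchange-Candidate: compute the set `U`. -/
def exchangeCandidate {N : Type u} [DecidableEq N] {m : ℕ} (tie : TieRule N m) : Command N m :=
  .forMatroid (exchangeIn tie)

/-- Compute `f(U : S)`, the sum of `f(x : S)` over `x ∈ U`. -/
def computeLoss {N : Type u} [DecidableEq N] {m : ℕ} : Command N m :=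
  .forElem (fun M => M.U) (fun x =>
    .seq (.value (fun M => insert x (before M.S x)) (fun v M => { M with loss := M.loss + v }))
      (.value (fun M => before M.S x) (fun v M => { M with loss := M.loss - v })))

/-- Compute `f(u ∣ S) = f(S + u) - f(S)`. -/
def computeGain {N : Type u} [DecidableEq N] {m : ℕ} : Command N m :=
  .seq (.value (fun M => insert M.u M.S.toFinset) (fun v M => { M with gain := v }))
    (.value (fun M => M.S.toFinset) (fun v M => { M with gain := M.gain - v }))

/-- If `f(u ∣ S) ≥ (1 + c) f(U : S)`, replace `S` by `(S \ U) + u`. -/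
def decideExchange {N : Type u} [DecidableEq N] (c : ℝ) (M : Memory N) : Memory N :=
  if M.valid = true ∧ (1 + c) * M.loss ≤ M.gain then
    { M with S := M.S.filter (fun x => decide (x ∉ M.U)) ++ [M.u] }
  else M

/-- The treatment of a sampled element. -/
def considerElement {N : Type u} [DecidableEq N] {m : ℕ} (c : ℝ) (tie : TieRule N m) :
    Command N m :=
  .seq (exchangeCandidate tie)
    (.seq computeLoss (.seq computeGain (.update (decideExchange c))))

/-- The memory when `u` arrives; only the solution `S` is kept from the past. -/
def initialMemory {N : Type u} (S : List N) (u : N) : Memory N where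
  u := u
  S := S
  U := []
  X := []
  best := none
  val := 0
  gain := 0
  loss := 0
  ans := true
  valid := true

/-- The treatment of an arriving element `u`, where `coin` says whether `u` is sampled. -/
def arrive {N : Type u} [DecidableEq N] {m : ℕ} (f : Finset N → ℝ)
    (I : Fin m → Finset N → Bool) (c : ℝ) (tie : TieRule N m) (coin : Bool) (S : List N) (u : N) :
    Outcome N :=
  if coin then (considerElement c tie).exec f I (initialMemory S u)
  else Outcome.idle (initialMemory S u)

/-- The solution `S_i` after the first `i` elements of the stream, for the coin tosses `ω`. -/
def solution {N : Type u} [DecidableEq N] {n m : ℕ} (f : Finset N → ℝ)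
    (I : Fin m → Finset N → Bool) (c : ℝ) (tie : TieRule N m) (stream : Fin n ≃ N)
    (ω : Fin n → Bool) : ℕ → List N
  | 0 => []
  | i + 1 =>
      if h : i < n then
        (arrive f I c tie (ω ⟨i, h⟩) (solution f I c tie stream ω i) (stream ⟨i, h⟩)).mem.S
      else solution f I c tie stream ω i

open Classical in
/-- The independence oracle of the `ℓ`-th matroid: is `T ∩ N_ℓ` in `I_ℓ`? -/
def indepOracle {N : Type u} {m : ℕ} (Ms : Fin m → Matroid N) (ℓ : Fin m) (T : Finset N) : Bool :=
  decide ((Ms ℓ).Indep ((T : Set N) ∩ (Ms ℓ).E))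

/-- The set that Sample-Streaming returns, for the coin tosses `ω`. -/
def output {N : Type u} [DecidableEq N] {n m : ℕ} (f : Finset N → ℝ) (Ms : Fin m → Matroid N)
    (c : ℝ) (tie : TieRule N m) (stream : Fin n ≃ N) (ω : Fin n → Bool) : Finset N :=
  (solution f (indepOracle Ms) c tie stream ω n).toFinset

/-- The execution of Sample-Streaming during the arrival of the `i`-th element. -/
def arrivalOutcome {N : Type u} [DecidableEq N] {n m : ℕ} (f : Finset N → ℝ)
    (Ms : Fin m → Matroid N) (c : ℝ) (tie : TieRule N m) (stream : Fin n ≃ N) (ω : Fin n → Bool)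
    (i : Fin n) : Outcome N :=
  arrive f (indepOracle Ms) c tie (ω i) (solution f (indepOracle Ms) c tie stream ω i) (stream i)

/-- The sampling probability `q = ((1 + c) p + 1)⁻¹`. -/
def samplingProb (c : ℝ) (p : ℕ) : ℝ := ((1 + c) * p + 1)⁻¹

/-- Expectation over `n` independent coin tosses, each `true` with probability `q`. -/
def expectation {n : ℕ} (q : ℝ) (g : (Fin n → Bool) → ℝ) : ℝ :=
  ∑ ω : Fin n → Bool, (∏ i : Fin n, if ω i then q else 1 - q) * g ω

end

end SampleStreaming

/-! Fix the coin tosses. Let `A` be the set of elements ever accepted and `R` the set of those that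
would be rejected even if sampled; let `g x` be the marginal of `x` to the solution on arrival, `S`
the final solution, and `v x` the last value `f(x : S)` while `x` was held. Each exchange raises
`f(S)` by at least `c` times the value of what is removed, so the total removed value `L` satisfies
`c * L ≤ f(S) - f(∅)`, while `f(A) ≤ f(S) + L`.

Rejected elements are charged to matroids. The removal candidates for `u` in matroid `ℓ`, together
with `u`, form a circuit, and `x_ℓ` is its cheapest old element. Give `u` the weight `w ℓ u = f(x_ℓ
: S)`; then `u` is spanned by held elements of value at least `w ℓ u`. If `x_ℓ` is later exchanged,
the rest of that circuit spans it and has no smaller values, so these threshold spans survive in the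
set `leaf ℓ` of accepted elements not exchanged through `ℓ`. Hence an independent set contains at
most as many elements with `w ℓ ≥ t` as `leaf ℓ` contains elements of the matroid with `v ≥ t`;
summing over thresholds bounds the weight of `OPT` by the value of the leaves
(`RunInvariant.sum_w_le`). An element of `S` lies in at most `p` leaves that count, a removed one in
at most `p - 1` (`RunInvariant.sum_gain_le`).

Together this gives `RunInvariant.union_le`: `f(OPT ∪ A)` plus `(1 + c) p` times the gain of `OPT ∩
A` is at most `(1 + c)² p / c` times `f(S) - f(∅)`, plus `f(∅)` and the gain of `OPT \ (A ∪ R)`.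
Whether an element would be accepted, and its gain, are settled before its toss; since `(1 + c) p q
= 1 - q`, the two gain terms have equal expectation and cancel (`exists_expectation_union_le`). It
remains to bound `f(OPT ∪ A)` from below: by `f(OPT)` if `f` is monotone, and in general by `(1 - q)
f(OPT)` in expectation, because `A` contains each element with probability at most `q`
(`Submodular.le_expectation`).

Feasibility, memory and query bounds come from a Hoare-style calculus for the programs, which also
shows that a run depends on the oracles only through the minimizers chosen. -/

namespace SampleStreaming

noncomputable section

/-! ### Reasoning about executions -/

section Exec

variable {N : Type u} {m : ℕ} {f : Finset N → ℝ} {I : Fin m → Finset N → Bool}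

/-- The outcome `r` ends in a memory satisfying `Q`, after at most `q` queries and with a peak
memory usage of at most `b`. -/
def Outcome.Meets (r : Outcome N) (Q : Memory N → Prop) (q b : ℕ) : Prop :=
  Q r.mem ∧ r.queries ≤ q ∧ r.peak ≤ b

lemma Outcome.Meets.mono {r : Outcome N} {Q Q' : Memory N → Prop} {q q' b b' : ℕ}
    (h : r.Meets Q q b) (hQ : ∀ M, Q M → Q' M) (hq : q ≤ q') (hb : b ≤ b') : r.Meets Q' q' b' :=
  ⟨hQ _ h.1, h.2.1.trans hq, h.2.2.trans hb⟩

lemma Outcome.Meets.andThen {r : Outcome N} {h : Memory N → Outcome N} {P Q : Memory N → Prop}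
    {q q' b : ℕ} (hr : r.Meets P q b) (hh : ∀ M, P M → (h M).Meets Q q' b) :
    (r.andThen h).Meets Q (q + q') b := by
  obtain ⟨h1, h2, h3⟩ := hh _ hr.1
  exact ⟨h1, add_le_add hr.2.1 h2, max_le hr.2.2 h3⟩

/-- The loop rule: the invariant `J` is indexed by the part of the list already processed. Knowing
that this part is a prefix of `l` lets a loop body use its length and the distinctness of its
entries. -/
lemma Outcome.Meets.foldl {α : Type*} {h : α → Memory N → Outcome N} {q b : ℕ}
    {J : List α → Memory N → Prop} (l : List α) {M : Memory N} (h0 : J [] M) (hb : M.size ≤ b)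
    (step : ∀ pre x, pre ++ [x] <+: l → ∀ M', J pre M' → (h x M').Meets (J (pre ++ [x])) q b) :
    (l.foldl (fun r x => r.andThen (h x)) (Outcome.idle M)).Meets (J l) (l.length * q) b := by
  induction l using List.reverseRecOn with
  | nil => exact ⟨h0, Nat.zero_le _, hb⟩
  | append_singleton l x ih =>
    rw [List.foldl_append, List.foldl_cons, List.foldl_nil, List.length_append,
      List.length_singleton, add_mul, one_mul]
    exact (ih fun pre y hy => step pre y (hy.trans (List.prefix_append _ _))).andThen
      fun M' hM' => step l x List.prefix_rfl M' hM'

lemma exec_seq {a b : Command N m} {M : Memory N} {P Q : Memory N → Prop} {q q' B : ℕ}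
    (ha : (a.exec f I M).Meets P q B) (hb : ∀ M', P M' → (b.exec f I M').Meets Q q' B) :
    ((Command.seq a b).exec f I M).Meets Q (q + q') B := by
  rw [Command.exec]
  exact ha.andThen hb

lemma exec_update {g : Memory N → Memory N} {M : Memory N} {Q : Memory N → Prop} {B : ℕ}
    (hQ : Q (g M)) (h1 : M.size ≤ B) (h2 : (g M).size ≤ B) :
    ((Command.update g : Command N m).exec f I M).Meets Q 0 B := by
  rw [Command.exec]
  exact ⟨hQ, le_rfl, max_le h1 h2⟩

lemma exec_value {A : Memory N → Finset N} {g : ℝ → Memory N → Memory N} {M : Memory N}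
    {Q : Memory N → Prop} {B : ℕ} (hQ : Q (g (f (A M)) M)) (h1 : M.size + (A M).card ≤ B)
    (h2 : (g (f (A M)) M).size ≤ B) :
    ((Command.value A g : Command N m).exec f I M).Meets Q 1 B := by
  rw [Command.exec]
  exact ⟨hQ, le_rfl, max_le h1 h2⟩

lemma exec_indep {ℓ : Fin m} {A : Memory N → Finset N} {g : Bool → Memory N → Memory N}
    {M : Memory N} {Q : Memory N → Prop} {B : ℕ} (hQ : Q (g (I ℓ (A M)) M))
    (h1 : M.size + (A M).card ≤ B) (h2 : (g (I ℓ (A M)) M).size ≤ B) :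
    ((Command.indep ℓ A g : Command N m).exec f I M).Meets Q 1 B := by
  rw [Command.exec]
  exact ⟨hQ, le_rfl, max_le h1 h2⟩

lemma exec_forElem {L : Memory N → List N} {body : N → Command N m} {M : Memory N} {q b : ℕ}
    {J : List N → Memory N → Prop} (h0 : J [] M) (hb : M.size ≤ b)
    (step : ∀ pre x, pre ++ [x] <+: L M → ∀ M', J pre M' →
      ((body x).exec f I M').Meets (J (pre ++ [x])) q b) :
    ((Command.forElem L body).exec f I M).Meets (J (L M)) ((L M).length * q)
      (b + (L M).length) := by
  rw [Command.exec]
  obtain ⟨h1, h2, h3⟩ := Outcome.Meets.foldl (h := fun x => (body x).exec f I) (L M) h0 hb step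
  exact ⟨h1, h2, Nat.add_le_add_right h3 _⟩

lemma exec_forMatroid {body : Fin m → Command N m} {M : Memory N} {q b : ℕ}
    {J : List (Fin m) → Memory N → Prop} (h0 : J [] M) (hb : M.size ≤ b)
    (step : ∀ pre x, x ∉ pre → ∀ M', J pre M' → ((body x).exec f I M').Meets (J (pre ++ [x])) q b) :
    ((Command.forMatroid body).exec f I M).Meets (J (List.finRange m)) (m * q) (b + 1) := by
  rw [Command.exec]
  obtain ⟨h1, h2, h3⟩ := Outcome.Meets.foldl (h := fun x => (body x).exec f I)
    (List.finRange m) h0 hb (fun pre x hpre => step pre x fun hx => by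
      have := hpre.sublist.nodup (List.nodup_finRange m)
      rw [List.nodup_append] at this
      exact this.2.2 x hx x (by simp) rfl)
  rw [List.length_finRange] at h2
  exact ⟨h1, h2, Nat.add_le_add_right h3 _⟩

end Exec

/-! ### The treatment of one element -/

section Step

variable {N : Type u} [DecidableEq N] {m : ℕ} {f : Finset N → ℝ} {I : Fin m → Finset N → Bool}

/-- The value `f(x : S)`. -/
def contribution (f : Finset N → ℝ) (S : List N) (x : N) : ℝ :=
  f (insert x (before S x)) - f (before S x)

lemma card_before_le (S : List N) (x : N) : (before S x).card ≤ S.length :=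
  (List.toFinset_card_le _).trans (List.takeWhile_sublist _).length_le

lemma card_insert_before_le (S : List N) (x : N) :
    (insert x (before S x)).card ≤ S.length + 1 :=
  (Finset.card_insert_le _ _).trans (Nat.add_le_add_right (card_before_le S x) 1)

/-- `o` is the element of `X_ℓ` that is added to `U`, if there is one. -/
structure IsChoice (f : Finset N → ℝ) (I : Fin m → Finset N → Bool) (S : List N) (u : N)
    (ℓ : Fin m) (o : Option N) : Prop where
  eq_none : I ℓ (insert u S.toFinset) = true → o = none
  mem : ∀ x, o = some x → x ∈ S
  indep : ∀ x, o = some x → I ℓ (insert u (S.toFinset.erase x)) = true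
  minimal : ∀ x, o = some x → ∀ y ∈ S, I ℓ (insert u (S.toFinset.erase y)) = true →
    contribution f S x ≤ contribution f S y
  empty : I ℓ (insert u S.toFinset) = false → o = none →
    ∀ y ∈ S, I ℓ (insert u (S.toFinset.erase y)) = false

/-- The memory after the matroids in the list `pre` have been treated. -/
structure Exchanged (f : Finset N → ℝ) (I : Fin m → Finset N → Bool) (S : List N) (u : N)
    (xs : Fin m → Option N) (pre : List (Fin m)) (M : Memory N) : Prop where
  u_eq : M.u = u
  S_eq : M.S = S
  loss_eq : M.loss = 0
  nodup : M.U.Nodup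
  subset : M.U ⊆ S
  length_X : M.X.length ≤ S.length
  choice : ∀ ℓ ∈ pre, IsChoice f I S u ℓ (xs ℓ)
  mem_U : ∀ x, x ∈ M.U ↔ ∃ ℓ ∈ pre, xs ℓ = some x
  valid_iff : M.valid = true ↔
    ∀ ℓ ∈ pre, I ℓ (insert u S.toFinset) = false → xs ℓ ≠ none

omit [DecidableEq N] in
lemma length_le_of_nodup_subset {U S : List N} (h : U.Nodup) (h' : U ⊆ S) :
    U.length ≤ S.length :=
  (h.subperm h').length_le

/-- The best element after the elements of `pre` have been compared. -/
def IsBest (f : Finset N → ℝ) (S : List N) (pre : List N) (b : Option (N × ℝ)) : Prop :=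
  (b = none → pre = []) ∧ ∀ x w, b = some (x, w) →
    x ∈ pre ∧ w = contribution f S x ∧ ∀ y ∈ pre, w ≤ contribution f S y

lemma IsBest.challenge {tie : TieRule N m} {ℓ : Fin m} {x : N} {pre : List N} {M : Memory N}
    (h : IsBest f M.S pre M.best) (hv : M.val = contribution f M.S x) :
    ∃ b, SampleStreaming.challenge tie ℓ x M = { M with best := b } ∧
      IsBest f M.S (pre ++ [x]) b := by
  unfold SampleStreaming.challenge
  rcases hb : M.best with _ | ⟨y, w⟩
  · refine ⟨some (x, M.val), rfl, by simp, ?_⟩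
    rintro x' w' h'
    simp only [Option.some.injEq, Prod.mk.injEq] at h'
    obtain ⟨rfl, rfl⟩ := h'
    have := h.1 hb
    subst this
    simp [hv]
  · obtain ⟨h1, h2, h3⟩ := h.2 y w hb
    by_cases hc : M.val < w ∨ (M.val = w ∧ tie ℓ M.S.toFinset M.u x y = true)
    · refine ⟨some (x, M.val), by simp [hc], by simp, ?_⟩
      rintro x' w' h'
      simp only [Option.some.injEq, Prod.mk.injEq] at h'
      obtain ⟨rfl, rfl⟩ := h'
      have hw : M.val ≤ w := hc.elim le_of_lt fun h => h.1.le
      refine ⟨by simp, hv, fun z hz => ?_⟩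
      rcases List.mem_append.1 hz with hz | hz
      · exact hw.trans (h3 z hz)
      · rw [List.mem_singleton.1 hz, hv]
    · refine ⟨some (y, w), by simp [hc, ← hb], by simp, ?_⟩
      rintro x' w' h'
      simp only [Option.some.injEq, Prod.mk.injEq] at h'
      obtain ⟨rfl, rfl⟩ := h'
      refine ⟨by simp [h1], h2, fun z hz => ?_⟩
      rcases List.mem_append.1 hz with hz | hz
      · exact h3 z hz
      · rw [List.mem_singleton.1 hz, ← hv]
        exact not_lt.1 fun h => hc (Or.inl h)

lemma exec_collect {ℓ : Fin m} {M : Memory N} (hX : M.X = []) (hU : M.U.length ≤ M.S.length) :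
    ((Command.forElem (fun M => M.S) (fun x =>
      .indep ℓ (fun M => insert M.u (M.S.toFinset.erase x))
        (fun b M => if b then { M with X := M.X ++ [x] } else M))).exec f I M).Meets
      (fun M' => M' = { M with
        X := M.S.filter (fun x => I ℓ (insert M.u (M.S.toFinset.erase x))) })
      M.S.length (5 * M.S.length + 10) := by
  -- Inside the loop, three lists of length at most `|S|`, nine cells and a queried set of size at
  -- most `|S| + 1` make `4|S| + 10`; the loop's own copy of the list adds `|S|`.
  have key := exec_forElem (f := f) (I := I) (L := fun M : Memory N => M.S) (q := 1)
    (b := 4 * M.S.length + 10) (M := M)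
    (body := fun x => .indep ℓ (fun M => insert M.u (M.S.toFinset.erase x))
        (fun b M => if b then { M with X := M.X ++ [x] } else M))
    (J := fun pre M' => M' = { M with
        X := pre.filter (fun x => I ℓ (insert M.u (M.S.toFinset.erase x))) })
    (by rw [List.filter_nil, ← hX]) (by simp only [Memory.size, hX, List.length_nil]; omega) ?_
  · exact key.mono (fun _ h => h) (by simp) (by omega)
  · rintro pre x hpre M' rfl
    have h1 := (List.length_filter_le (fun x => I ℓ (insert M.u (M.S.toFinset.erase x))) pre)
    have h2 := hpre.length_le
    rw [List.length_append, List.length_singleton] at h2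
    have h3 : (insert M.u (M.S.toFinset.erase x)).card ≤ M.S.length + 1 :=
      (Finset.card_insert_le _ _).trans (Nat.add_le_add_right
        ((Finset.card_erase_le).trans (List.toFinset_card_le _)) 1)
    apply exec_indep
    · by_cases h : I ℓ (insert M.u (M.S.toFinset.erase x)) = true
      · simp [h]
      · simp [h]
    · simp only [Memory.size]
      omega
    · simp only
      split_ifs <;> simp only [Memory.size, List.length_append, List.length_singleton] <;> omega

lemma exec_compare {tie : TieRule N m} {ℓ : Fin m} {M : Memory N} (hb : M.best = none)
    (hX : M.X.length ≤ M.S.length) (hU : M.U.length ≤ M.S.length) :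
    ((Command.forElem (fun M => M.X) (fun x =>
        .seq (.value (fun M => insert x (before M.S x)) (fun v M => { M with val := v }))
          (.seq (.value (fun M => before M.S x) (fun v M => { M with val := M.val - v }))
            (.update (challenge tie ℓ x))))).exec f I M).Meets
      (fun M' => ∃ v b, M' = { M with val := v, best := b } ∧ IsBest f M.S M.X b)
      (2 * M.S.length) (5 * M.S.length + 10) := by
  have key := exec_forElem (f := f) (I := I) (L := fun M : Memory N => M.X) (q := 2)
    (b := 4 * M.S.length + 10) (M := M)
    (body := fun x =>
        .seq (.value (fun M => insert x (before M.S x)) (fun v M => { M with val := v }))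
          (.seq (.value (fun M => before M.S x) (fun v M => { M with val := M.val - v }))
            (.update (challenge tie ℓ x))))
    (J := fun pre M' => ∃ v b, M' = { M with val := v, best := b } ∧ IsBest f M.S pre b)
    ⟨M.val, none, by simp [← hb], by simp [IsBest]⟩ (by simp only [Memory.size]; omega) ?_
  · exact key.mono (fun _ h => h) (by omega) (by omega)
  · rintro pre x hpre M' ⟨v, b, rfl, hbest⟩
    have h1 := card_before_le M.S x
    have h2 := card_insert_before_le M.S x
    refine (exec_seq (q := 1) (q' := 1) (P := fun M' => M' =
      { M with val := f (insert x (before M.S x)), best := b }) ?_ ?_)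
    · apply exec_value
      · simp
      · simp only [Memory.size]
        omega
      · simp only [Memory.size]
        omega
    rintro M' rfl
    refine (exec_seq (q := 1) (q' := 0) (P := fun M' => M' =
      { M with val := contribution f M.S x, best := b }) ?_ ?_)
    · apply exec_value
      · simp [contribution]
      · simp only [Memory.size]
        omega
      · simp only [Memory.size]
        omega
    rintro M' rfl
    obtain ⟨b', hb', hbest'⟩ := IsBest.challenge (f := f) (tie := tie) (ℓ := ℓ) (x := x) (pre := pre)
      (M := { M with val := contribution f M.S x, best := b }) hbest rfl
    apply exec_update
    · exact ⟨_, b', hb', hbest'⟩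
    · simp only [Memory.size]
      omega
    · rw [hb']
      simp only [Memory.size]
      omega

/-- The choice for `ℓ` is recorded by updating `xs` at `ℓ`; as `ℓ` is new, earlier choices are
untouched. One element chosen for several matroids enters `U` only once. -/
lemma Exchanged.extend {S : List N} {u : N} {xs : Fin m → Option N} {pre : List (Fin m)}
    {M M' : Memory N} (h : Exchanged f I S u xs pre M) {ℓ : Fin m} {o : Option N}
    (ho : IsChoice f I S u ℓ o) (hu : M'.u = u) (hS : M'.S = S) (hl : M'.loss = 0)
    (hX : M'.X.length ≤ S.length)
    (hU : M'.U = o.elim M.U fun x => if x ∈ M.U then M.U else M.U ++ [x])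
    (hv : M'.valid = true ↔ M.valid = true ∧ (I ℓ (insert u S.toFinset) = false → o ≠ none))
    (hpre : ℓ ∉ pre) :
    Exchanged f I S u (Function.update xs ℓ o) (pre ++ [ℓ]) M' := by
  have hne : ∀ ℓ' ∈ pre, Function.update xs ℓ o ℓ' = xs ℓ' := fun ℓ' h' =>
    Function.update_of_ne (fun h'' : ℓ' = ℓ => hpre (h'' ▸ h')) _ _
  have hmem : ∀ x, x ∈ M'.U ↔ x ∈ M.U ∨ o = some x := by
    intro x
    rw [hU]
    rcases o with _ | y
    · simp
    · by_cases hy : y ∈ M.U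
      · simp only [Option.elim, hy, if_true, Option.some.injEq]
        exact ⟨Or.inl, fun h => h.elim id fun h => h ▸ hy⟩
      · simp [hy, eq_comm]
  refine ⟨hu, hS, hl, ?_, ?_, hX, ?_, ?_, ?_⟩
  · rw [hU]
    rcases o with _ | y
    · exact h.nodup
    · by_cases hy : y ∈ M.U
      · simpa [hy] using h.nodup
      · simp only [Option.elim, hy, if_false]
        rw [← List.concat_eq_append]
        exact h.nodup.concat hy
  · intro x hx
    exact ((hmem x).1 hx).elim (fun h' => h.subset h') fun h' => ho.mem x h'
  · intro ℓ' hℓ'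
    rcases List.mem_append.1 hℓ' with h' | h'
    · rw [hne _ h']
      exact h.choice _ h'
    · rw [List.mem_singleton.1 h', Function.update_self]
      exact ho
  · intro x
    rw [hmem, h.mem_U]
    constructor
    · rintro (⟨ℓ', h1, h2⟩ | h1)
      · exact ⟨ℓ', by simp [h1], by rw [hne _ h1, h2]⟩
      · exact ⟨ℓ, by simp, by simp [h1]⟩
    · rintro ⟨ℓ', h1, h2⟩
      rcases List.mem_append.1 h1 with h' | h'
      · exact Or.inl ⟨ℓ', h', by rw [← h2, hne _ h']⟩
      · rw [List.mem_singleton.1 h', Function.update_self] at h2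
        exact Or.inr h2
  · rw [hv, h.valid_iff]
    constructor
    · rintro ⟨h1, h2⟩ ℓ' hℓ'
      rcases List.mem_append.1 hℓ' with h' | h'
      · rw [hne _ h']
        exact h1 _ h'
      · rw [List.mem_singleton.1 h', Function.update_self]
        exact h2
    · intro h1
      refine ⟨fun ℓ' h' => ?_, ?_⟩
      · rw [← hne _ h']
        exact h1 _ (by simp [h'])
      · have := h1 ℓ (by simp)
        rwa [Function.update_self] at this

lemma exec_exchangeIn {tie : TieRule N m} {ℓ : Fin m} {S : List N} {u : N}
    {xs : Fin m → Option N} {pre : List (Fin m)} {M : Memory N}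
    (h : Exchanged f I S u xs pre M) (hpre : ℓ ∉ pre) :
    ((exchangeIn tie ℓ).exec f I M).Meets
      (fun M' => ∃ xs', Exchanged f I S u xs' (pre ++ [ℓ]) M')
      (3 * S.length + 1) (5 * S.length + 10) := by
  have hU := length_le_of_nodup_subset h.nodup h.subset
  have hXl := h.length_X
  have hcard : (insert u S.toFinset).card ≤ S.length + 1 :=
    (Finset.card_insert_le _ _).trans (Nat.add_le_add_right (List.toFinset_card_le _) 1)
  obtain ⟨rfl, rfl⟩ : M.u = u ∧ M.S = S := ⟨h.u_eq, h.S_eq⟩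
  -- One initial independence query, one for each element of `S`, two value queries for each
  -- candidate in `X`, and none for the final update.
  have key : ((exchangeIn tie ℓ).exec f I M).Meets
      (fun M' => ∃ xs', Exchanged f I M.S M.u xs' (pre ++ [ℓ]) M')
      (1 + (M.S.length + (2 * M.S.length + 0))) (5 * M.S.length + 10) := by
    refine exec_seq (P := fun M' => M' =
      { M with ans := I ℓ (insert M.u M.S.toFinset), X := [], best := none }) ?_ ?_
    · apply exec_indep
      · rfl
      · simp only [Memory.size]
        omega
      · simp only [Memory.size, List.length_nil]
        omega
    rintro M' rfl
    rw [Command.exec]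
    by_cases hans : I ℓ (insert M.u M.S.toFinset) = true
    · simp only [hans, if_true]
      refine ⟨⟨_, h.extend (o := none) ⟨fun _ => rfl, by simp, by simp, by simp, by simp [hans]⟩
        rfl rfl h.loss_eq (by simp [Outcome.idle]) rfl (by simp [Outcome.idle, hans]) hpre⟩,
        Nat.zero_le _, ?_⟩
      simp only [Outcome.idle, Memory.size, List.length_nil]
      omega
    rw [if_neg (by simpa using hans)]
    have hans' : I ℓ (insert M.u M.S.toFinset) = false := by simpa using hans
    refine exec_seq (exec_collect rfl hU) ?_
    rintro M' rfl
    have hfl := List.length_filter_le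
      (fun x => I ℓ (insert M.u (M.S.toFinset.erase x))) M.S
    refine exec_seq (exec_compare rfl hfl hU) ?_
    rintro M' ⟨v, b, rfl, hb⟩
    have hUx : ∀ x, (if x ∈ M.U then M.U else M.U ++ [x]).length ≤ M.U.length + 1 := by
      intro x
      split_ifs <;> simp
    rcases b with _ | ⟨x, w⟩
    · apply exec_update
      · refine ⟨_, h.extend (o := none) ⟨fun _ => rfl, by simp, by simp, by simp, ?_⟩
          rfl rfl h.loss_eq hfl rfl (by simp [addBest, hans']) hpre⟩
        intro _ _ y hy
        have := hb.1 rfl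
        simp only [List.filter_eq_nil_iff] at this
        simpa using this y hy
      · simp only [Memory.size]
        omega
      · simp only [addBest, Memory.size]
        omega
    · obtain ⟨h1, h2, h3⟩ := hb.2 x w rfl
      simp only [List.mem_filter] at h1 h3
      apply exec_update
      · refine ⟨_, h.extend (o := some x) ⟨by simp [hans'], ?_, ?_, ?_, by simp⟩
          rfl rfl h.loss_eq hfl rfl (by simp [addBest]) hpre⟩
        · rintro _ ⟨⟩
          exact h1.1
        · rintro _ ⟨⟩
          exact h1.2
        · rintro _ ⟨⟩ y hy hy'
          exact h2 ▸ h3 y ⟨hy, hy'⟩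
      · simp only [Memory.size]
        omega
      · have := hUx x
        simp only [addBest, Memory.size]
        omega
  exact key.mono (fun _ h => h) (by omega) le_rfl

lemma exec_exchangeCandidate (tie : TieRule N m) (S : List N) (u : N) :
    ((exchangeCandidate tie).exec f I (initialMemory S u)).Meets
      (fun M' => ∃ xs, Exchanged f I S u xs (List.finRange m) M')
      (m * (3 * S.length + 1)) (5 * S.length + 11) :=
  exec_forMatroid (J := fun pre M' => ∃ xs, Exchanged f I S u xs pre M')
    ⟨fun _ => none, rfl, rfl, rfl, List.nodup_nil, by simp [initialMemory],
      by simp [initialMemory], by simp, by simp [initialMemory], by simp [initialMemory]⟩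
    (by simp only [initialMemory, Memory.size, List.length_nil]; omega)
    fun _ _ hpre _ ⟨_, h⟩ => exec_exchangeIn h hpre

lemma exec_computeLoss {M : Memory N} (hU : M.U.length ≤ M.S.length)
    (hX : M.X.length ≤ M.S.length) (hl : M.loss = 0) :
    ((computeLoss : Command N m).exec f I M).Meets
      (fun M' => M' = { M with loss := (M.U.map (contribution f M.S)).sum })
      (2 * M.S.length) (5 * M.S.length + 11) := by
  have key := exec_forElem (f := f) (I := I) (L := fun M : Memory N => M.U) (q := 2)
    (b := 4 * M.S.length + 11) (M := M)
    (body := fun x =>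
      .seq (.value (fun M => insert x (before M.S x)) (fun v M => { M with loss := M.loss + v }))
      (.value (fun M => before M.S x) (fun v M => { M with loss := M.loss - v })))
    (J := fun pre M' => M' = { M with loss := (pre.map (contribution f M.S)).sum })
    (by rw [List.map_nil, List.sum_nil, ← hl]) (by simp only [Memory.size]; omega) ?_
  · exact key.mono (fun _ h => h) (by omega) (by omega)
  · rintro pre x hpre M' rfl
    have h1 := card_before_le M.S x
    have h2 := card_insert_before_le M.S x
    refine (exec_seq (q := 1) (q' := 1) (P := fun M' => M' =
      { M with
        loss := (pre.map (contribution f M.S)).sum + f (insert x (before M.S x)) }) ?_ ?_)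
    · apply exec_value
      · rfl
      · simp only [Memory.size]
        omega
      · simp only [Memory.size]
        omega
    rintro M' rfl
    apply exec_value
    · simp [contribution, add_sub_assoc]
    · simp only [Memory.size]
      omega
    · simp only [Memory.size]
      omega

lemma exec_computeGain {M : Memory N} (hU : M.U.length ≤ M.S.length)
    (hX : M.X.length ≤ M.S.length) :
    ((computeGain : Command N m).exec f I M).Meets
      (fun M' => M' = { M with gain := f (insert M.u M.S.toFinset) - f M.S.toFinset })
      2 (5 * M.S.length + 11) := by
  have h1 : M.S.toFinset.card ≤ M.S.length := List.toFinset_card_le _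
  have h2 : (insert M.u M.S.toFinset).card ≤ M.S.length + 1 :=
    (Finset.card_insert_le _ _).trans (Nat.add_le_add_right h1 1)
  refine (exec_seq (q := 1) (q' := 1) (P := fun M' => M' =
      { M with gain := f (insert M.u M.S.toFinset) }) ?_ ?_)
  · apply exec_value
    · rfl
    · simp only [Memory.size]
      omega
    · simp only [Memory.size]
      omega
  rintro M' rfl
  apply exec_value
  · rfl
  · simp only [Memory.size]
    omega
  · simp only [Memory.size]
    omega

/-- The set `U` that is built from the choices `xs`. -/
def exchangeSet (xs : Fin m → Option N) : Finset N :=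
  Finset.univ.biUnion fun ℓ => (xs ℓ).toFinset

lemma mem_exchangeSet {xs : Fin m → Option N} {x : N} :
    x ∈ exchangeSet xs ↔ ∃ ℓ, xs ℓ = some x := by
  simp [exchangeSet]

open Classical in
/-- The solution after a sampled element `u` has been treated, in terms of the choices `xs`. -/
def exchangeStep (f : Finset N → ℝ) (I : Fin m → Finset N → Bool) (c : ℝ)
    (xs : Fin m → Option N) (S : List N) (u : N) : List N :=
  if (∀ ℓ, I ℓ (insert u S.toFinset) = false → xs ℓ ≠ none) ∧
      (1 + c) * ∑ x ∈ exchangeSet xs, contribution f S x ≤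
        f (insert u S.toFinset) - f S.toFinset then
    S.filter (fun x => decide (x ∉ exchangeSet xs)) ++ [u]
  else S

lemma exec_considerElement (c : ℝ) (tie : TieRule N m) (S : List N) (u : N) :
    ((considerElement c tie).exec f I (initialMemory S u)).Meets
      (fun M' => ∃ xs : Fin m → Option N, (∀ ℓ, IsChoice f I S u ℓ (xs ℓ)) ∧
        M'.S = exchangeStep f I c xs S u)
      (m * (3 * S.length + 1) + 2 * S.length + 2) (5 * S.length + 11) := by
  have key : ((considerElement c tie).exec f I (initialMemory S u)).Meets
      (fun M' => ∃ xs : Fin m → Option N, (∀ ℓ, IsChoice f I S u ℓ (xs ℓ)) ∧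
        M'.S = exchangeStep f I c xs S u)
      (m * (3 * S.length + 1) + (2 * S.length + (2 + 0))) (5 * S.length + 11) := by
    refine exec_seq (exec_exchangeCandidate tie S u) ?_
    rintro M ⟨xs, h⟩
    have hU := length_le_of_nodup_subset h.nodup h.subset
    have hXl := h.length_X
    obtain ⟨rfl, rfl⟩ : M.u = u ∧ M.S = S := ⟨h.u_eq, h.S_eq⟩
    refine exec_seq (exec_computeLoss hU hXl h.loss_eq) ?_
    rintro M' rfl
    refine exec_seq (exec_computeGain hU hXl) ?_
    rintro M' rfl
    have hmem : ∀ x, x ∈ M.U ↔ x ∈ exchangeSet xs := fun x => by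
      rw [h.mem_U, mem_exchangeSet]
      simp
    have hsum : (M.U.map (contribution f M.S)).sum =
        ∑ x ∈ exchangeSet xs, contribution f M.S x := by
      rw [← List.sum_toFinset _ h.nodup]
      exact Finset.sum_congr (by ext x; simp [hmem]) fun _ _ => rfl
    have hvalid : M.valid = true ↔
        ∀ ℓ, I ℓ (insert M.u M.S.toFinset) = false → xs ℓ ≠ none := by
      rw [h.valid_iff]
      simp
    apply exec_update
    · refine ⟨xs, fun ℓ => h.choice ℓ (by simp), ?_⟩
      unfold decideExchange exchangeStep
      simp only [hsum, hvalid, hmem]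
      split_ifs <;> rfl
    · simp only [Memory.size]
      omega
    · have hfl := List.length_filter_le (fun x => decide (x ∉ M.U)) M.S
      unfold decideExchange
      split_ifs
      · simp only [Memory.size, List.length_append, List.length_singleton]
        omega
      · simp only [Memory.size]
        omega
  exact key.mono (fun _ h => h) (by omega) le_rfl

end Step

/-! ### Submodular functions along a list -/

section Lists

variable {N : Type u} [DecidableEq N] {f : Finset N → ℝ} {S : List N} {x u : N}

lemma Submodular.marginal_le (hf : Submodular f) {A B : Finset N} (h : A ⊆ B) (hx : x ∉ B) :
    f (insert x B) - f B ≤ f (insert x A) - f A := by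
  have h1 := hf (insert x A) B
  have h2 : insert x A ∪ B = insert x B := by
    rw [Finset.insert_union, Finset.union_eq_right.2 h]
  have h3 : insert x A ∩ B = A := by
    rw [Finset.insert_inter_of_notMem hx, Finset.inter_eq_left.2 h]
  rw [h2, h3] at h1
  linarith

lemma Submodular.union_le (hf : Submodular f) (A T : Finset N) :
    f (T ∪ A) ≤ f A + ∑ x ∈ T \ A, (f (insert x A) - f A) := by
  induction T using Finset.induction_on with
  | empty => simp
  | insert x T hx ih =>
    by_cases hA : x ∈ A
    · rw [Finset.insert_union, Finset.insert_eq_of_mem (Finset.mem_union_right _ hA),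
        Finset.insert_sdiff_of_mem _ hA]
      exact ih
    · rw [Finset.insert_union, Finset.insert_sdiff_of_notMem _ hA,
        Finset.sum_insert (by simp [hx])]
      have := hf.marginal_le (x := x) (Finset.subset_union_right : A ⊆ T ∪ A)
        (by simp [hx, hA])
      linarith

lemma notMem_before (S : List N) (x : N) : x ∉ before S x := fun h => by
  rw [before, List.mem_toFinset] at h
  simpa using List.mem_takeWhile_imp h

lemma before_append_of_mem (hx : x ∈ S) (T : List N) : before (S ++ T) x = before S x := by
  unfold before
  congr 1
  induction S with
  | nil => simp at hx
  | cons y S ih =>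
    by_cases h : y = x
    · simp [h]
    · rw [List.cons_append, List.takeWhile_cons_of_pos (by simpa using h),
        List.takeWhile_cons_of_pos (by simpa using h),
        ih ((List.mem_cons.1 hx).resolve_left (Ne.symm h))]

lemma before_append_self (hu : u ∉ S) : before (S ++ [u]) u = S.toFinset := by
  unfold before
  rw [List.takeWhile_append_of_pos (by
    intro a ha
    simpa using fun h : a = u => hu (h ▸ ha))]
  simp

lemma contribution_append_of_mem (hx : x ∈ S) (T : List N) :
    contribution f (S ++ T) x = contribution f S x := by
  rw [contribution, before_append_of_mem hx, contribution]

lemma contribution_append_self (hu : u ∉ S) :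
    contribution f (S ++ [u]) u = f (insert u S.toFinset) - f S.toFinset := by
  rw [contribution, before_append_self hu]

lemma before_filter_subset (P : N → Bool) (hx : x ∈ S.filter P) :
    before (S.filter P) x ⊆ before S x := by
  induction S with
  | nil => simp at hx
  | cons y S ih =>
    by_cases h : y = x
    · subst h
      rw [List.filter_cons_of_pos (List.of_mem_filter hx)]
      simp [before]
    · have hx' : x ∈ S.filter P := by
        simp only [List.mem_filter, List.mem_cons] at hx ⊢
        exact ⟨hx.1.resolve_left (Ne.symm h), hx.2⟩
      have h1 : before (y :: S) x = insert y (before S x) := by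
        unfold before
        rw [List.takeWhile_cons_of_pos (by simpa using h), List.toFinset_cons]
      rw [h1]
      by_cases hP : P y
      · have h2 : before (y :: S.filter P) x = insert y (before (S.filter P) x) := by
          unfold before
          rw [List.takeWhile_cons_of_pos (by simpa using h), List.toFinset_cons]
        rw [List.filter_cons_of_pos hP, h2]
        exact Finset.insert_subset_insert _ (ih hx')
      · rw [List.filter_cons_of_neg hP]
        exact (ih hx').trans (Finset.subset_insert _ _)

/-- Removing elements shrinks the prefix before `x`, so the value of a surviving element can only
grow. -/
lemma Submodular.contribution_le_filter (hf : Submodular f) (P : N → Bool)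
    (hx : x ∈ S.filter P) : contribution f S x ≤ contribution f (S.filter P) x :=
  hf.marginal_le (before_filter_subset P hx) (notMem_before S x)

lemma sum_contribution (f : Finset N → ℝ) (hS : S.Nodup) :
    ∑ x ∈ S.toFinset, contribution f S x = f S.toFinset - f ∅ := by
  induction S using List.reverseRecOn with
  | nil => simp
  | append_singleton S u ih =>
    rw [List.nodup_append] at hS
    have hu : u ∉ S := fun h => hS.2.2 u h u (by simp) rfl
    have h1 : (S ++ [u]).toFinset = insert u S.toFinset := by ext; simp
    rw [h1, Finset.sum_insert (by simpa using hu), contribution_append_self hu,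
      Finset.sum_congr rfl fun x hx => contribution_append_of_mem (List.mem_toFinset.1 hx) _,
      ih hS.1]
    ring

/-- Add the elements in order of arrival: an element of `U` costs exactly its contribution, and a
kept element has at least as large a marginal over the smaller, filtered prefix. -/
lemma Submodular.sub_filter_le (hf : Submodular f) (hS : S.Nodup) (U : Finset N) :
    f S.toFinset - f (S.filter (fun x => decide (x ∉ U))).toFinset ≤
      ∑ x ∈ S.toFinset ∩ U, contribution f S x := by
  induction S using List.reverseRecOn with
  | nil => simp
  | append_singleton S u ih =>
    rw [List.nodup_append] at hS
    have hu : u ∉ S := fun h => hS.2.2 u h u (by simp) rfl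
    have h1 : (S ++ [u]).toFinset = insert u S.toFinset := by ext; simp
    have h2 : ∑ x ∈ S.toFinset ∩ U, contribution f (S ++ [u]) x =
        ∑ x ∈ S.toFinset ∩ U, contribution f S x :=
      Finset.sum_congr rfl fun x hx => contribution_append_of_mem
        (List.mem_toFinset.1 (Finset.mem_inter.1 hx).1) _
    have ih := ih hS.1
    rw [h1, List.filter_append]
    by_cases hU : u ∈ U
    · rw [Finset.insert_inter_of_mem hU, Finset.sum_insert (by simp [hu]),
        contribution_append_self hu, h2]
      simp only [hU, not_true, decide_false, List.filter_cons_of_neg, List.filter_nil,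
        List.append_nil, Bool.false_eq_true, not_false_eq_true]
      linarith
    · rw [Finset.insert_inter_of_notMem hU, h2]
      have h3 : ((S.filter fun x => decide (x ∉ U)) ++
          [u].filter fun x => decide (x ∉ U)).toFinset =
          insert u (S.filter fun x => decide (x ∉ U)).toFinset := by
        ext y
        simp only [List.toFinset_append, Finset.mem_union, List.mem_toFinset, List.mem_filter,
          List.mem_singleton, Finset.mem_insert, decide_eq_true_eq]
        constructor
        · rintro (h | h)
          · exact Or.inr h
          · exact Or.inl h.1
        · rintro (rfl | h)
          · exact Or.inr ⟨rfl, hU⟩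
          · exact Or.inl h
      rw [h3]
      have := hf.marginal_le (x := u) (A := (S.filter fun x => decide (x ∉ U)).toFinset)
        (B := S.toFinset) (fun y hy => by simp at hy ⊢; exact hy.1) (by simpa using hu)
      linarith

end Lists

/-! ### Weights and spans in a matroid -/

section Matroids

variable {N : Type u}

/-- If every threshold is reached at most as often by `w` on `D` as by `v` on `L`, then
`∑ w ≤ ∑ v`. -/
lemma sum_le_sum_of_card_threshold_le [DecidableEq N] (D L : Finset N) (w v : N → ℝ)
    (hv : ∀ x ∈ L, 0 ≤ v x)
    (h : ∀ t : ℝ, 0 < t → (D.filter fun x => t ≤ w x).card ≤ (L.filter fun x => t ≤ v x).card) :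
    ∑ x ∈ D, w x ≤ ∑ x ∈ L, v x := by
  induction D using Finset.induction_on_max_value w generalizing L with
  | empty => simpa using Finset.sum_nonneg hv
  | insert a s ha hmax ih =>
    rcases le_or_gt (w a) 0 with h0 | h0
    · refine le_trans (Finset.sum_nonpos fun x hx => ?_) (Finset.sum_nonneg hv)
      rcases Finset.mem_insert.1 hx with rfl | hx
      · exact h0
      · exact (hmax x hx).trans h0
    have hne : (L.filter fun x => w a ≤ v x).Nonempty := by
      rw [← Finset.card_pos]
      exact lt_of_lt_of_le (Finset.card_pos.2 ⟨a, by simp⟩) (h _ h0)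
    obtain ⟨b₀, hb₀⟩ := hne
    rw [Finset.mem_filter] at hb₀
    -- The heaviest `a` is matched with the element `b` of largest value. Removing both lowers both
    -- counts by one for `t ≤ w a`; above `w a` nothing of `D` is left to count.
    obtain ⟨b, hb, hbmax⟩ := L.exists_max_image v ⟨b₀, hb₀.1⟩
    have hab : w a ≤ v b := hb₀.2.trans (hbmax _ hb₀.1)
    rw [Finset.sum_insert ha, ← Finset.add_sum_erase L v hb]
    refine add_le_add hab (ih _ (fun x hx => hv x (Finset.mem_of_mem_erase hx)) fun t ht => ?_)
    rcases le_or_gt t (w a) with hta | hta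
    · have h1 := h t ht
      rw [Finset.filter_insert, if_pos hta, Finset.card_insert_of_notMem (by simp [ha])] at h1
      rw [Finset.filter_erase, Finset.card_erase_of_mem (by simp [hb, hta.trans hab])]
      omega
    · rw [Finset.filter_false_of_mem fun x hx => not_le.2 ((hmax x hx).trans_lt hta)]
      simp

lemma card_le_card_of_indep_of_subset_closure {M : Matroid N} {I X : Finset N}
    (hI : M.Indep (I : Set N)) (h : (I : Set N) ⊆ M.closure X) : I.card ≤ X.card := by
  have h1 := (hI.encard_le_eRk_of_subset h).trans_eq (M.eRk_closure_eq X)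
  have h2 := h1.trans (M.eRk_le_encard _)
  simpa using h2

/-- The elements of `S` that can be exchanged for `u`. -/
def exchangeable (M : Matroid N) (S : Set N) (u : N) : Set N :=
  {y ∈ S | M.Indep (insert u (S \ {y}) ∩ M.E)}

section

variable {M : Matroid N} {S : Set N} {u : N}

lemma mem_ground_of_dependent (hS : M.Indep (S ∩ M.E)) (hu : ¬ M.Indep (insert u S ∩ M.E)) :
    u ∈ M.E := by
  by_contra h
  rw [Set.insert_inter_of_notMem h] at hu
  exact hu hS

/-- The exchangeable elements are those of the fundamental circuit of `u` over `S ∩ M.E`, other than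
`u`. Elements of `S` outside the ground set are not exchangeable, since deleting them leaves the
dependence intact. -/
lemma exists_circuit_of_dependent (hS : M.Indep (S ∩ M.E))
    (hu : ¬ M.Indep (insert u S ∩ M.E)) :
    M.IsCircuit (insert u (exchangeable M S u)) ∧ u ∉ exchangeable M S u := by
  have huE := mem_ground_of_dependent hS hu
  have huS : u ∉ S := fun h => hu (by rwa [Set.insert_eq_of_mem h])
  rw [Set.insert_inter_of_mem huE] at hu
  have hcl : u ∈ M.closure (S ∩ M.E) := by
    by_contra h
    exact hu ((hS.insert_indep_iff_of_notMem (fun h' => huS h'.1)).2 ⟨huE, h⟩)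
  have hC := hS.fundCircuit_isCircuit hcl (fun h => huS h.1)
  have hsub := M.fundCircuit_subset_insert u (S ∩ M.E)
  refine ⟨?_, fun h => huS h.1⟩
  convert hC using 1
  ext y
  rw [hS.mem_fundCircuit_iff hcl (fun h => huS h.1)]
  have key : y ≠ u → insert u (S \ {y}) ∩ M.E = insert u (S ∩ M.E) \ {y} := by
    intro hyu
    ext z
    simp only [Set.mem_inter_iff, Set.mem_insert_iff, Set.mem_sdiff, Set.mem_singleton_iff]
    constructor
    · rintro ⟨rfl | h, h'⟩
      · exact ⟨Or.inl rfl, hyu.symm⟩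
      · exact ⟨Or.inr ⟨h.1, h'⟩, h.2⟩
    · rintro ⟨rfl | h, h'⟩
      · exact ⟨Or.inl rfl, huE⟩
      · exact ⟨Or.inr ⟨h.1, h'⟩, h.2⟩
  by_cases hyu : y = u
  · subst hyu
    simp only [Set.mem_insert_iff, true_or, true_iff]
    rw [Set.insert_sdiff_self_of_notMem fun h => huS h.1]
    exact hS
  · rw [← key hyu]
    simp only [Set.mem_insert_iff, hyu, false_or, exchangeable, Set.mem_ofPred_eq]
    refine ⟨fun h => h.2, fun h => ⟨?_, h⟩⟩
    by_contra hyS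
    rw [Set.sdiff_singleton_eq_self hyS, Set.insert_inter_of_mem huE] at h
    exact hu h

lemma exchangeable_subset_ground (hS : M.Indep (S ∩ M.E))
    (hu : ¬ M.Indep (insert u S ∩ M.E)) : exchangeable M S u ⊆ M.E :=
  (Set.subset_insert _ _).trans (exists_circuit_of_dependent hS hu).1.subset_ground

lemma mem_closure_exchangeable (hS : M.Indep (S ∩ M.E)) (hu : ¬ M.Indep (insert u S ∩ M.E)) :
    u ∈ M.closure (exchangeable M S u) := by
  obtain ⟨h1, h2⟩ := exists_circuit_of_dependent hS hu
  have := h1.mem_closure_sdiff_singleton_of_mem (Set.mem_insert _ _)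
  rwa [Set.insert_sdiff_self_of_notMem h2] at this

lemma mem_closure_of_exchangeable (hS : M.Indep (S ∩ M.E))
    (hu : ¬ M.Indep (insert u S ∩ M.E)) {x : N} (hx : x ∈ exchangeable M S u) :
    x ∈ M.closure (insert u (exchangeable M S u) \ {x}) :=
  (exists_circuit_of_dependent hS hu).1.mem_closure_sdiff_singleton_of_mem
    (Set.mem_insert_of_mem _ hx)

/-- Otherwise the circuit would be `{u}` itself, making `u` a loop. -/
lemma exchangeable_nonempty (hS : M.Indep (S ∩ M.E)) (hu : ¬ M.Indep (insert u S ∩ M.E))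
    (hl : M.Indep ({u} ∩ M.E)) : (exchangeable M S u).Nonempty := by
  rw [Set.nonempty_iff_ne_empty]
  intro h
  have h1 := (exists_circuit_of_dependent hS hu).1
  rw [h] at h1
  refine h1.not_indep ?_
  convert hl using 1
  rw [Set.inter_eq_left.2 (Set.singleton_subset_iff.2 (mem_ground_of_dependent hS hu))]
  simp

end

end Matroids

/-! ### The analysis of one run -/

section Run

variable {N : Type u} [DecidableEq N] {m : ℕ} {f : Finset N → ℝ} {Ms : Fin m → Matroid N} {c : ℝ}

lemma indepOracle_insert {ℓ : Fin m} {S : Finset N} {u : N} :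
    indepOracle Ms ℓ (insert u S) = true ↔
      (Ms ℓ).Indep (insert u (S : Set N) ∩ (Ms ℓ).E) := by
  simp [indepOracle]

lemma indepOracle_insert_erase {ℓ : Fin m} {S : Finset N} {u x : N} :
    indepOracle Ms ℓ (insert u (S.erase x)) = true ↔
      (Ms ℓ).Indep (insert u ((S : Set N) \ {x}) ∩ (Ms ℓ).E) := by
  simp [indepOracle]

section

variable {S : List N} {u x : N} {ℓ : Fin m} {o : Option N}

lemma IsChoice.dependent (h : IsChoice f (indepOracle Ms) S u ℓ (some x)) :
    ¬ (Ms ℓ).Indep (insert u (S.toFinset : Set N) ∩ (Ms ℓ).E) := fun hi => by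
  simpa using h.eq_none (indepOracle_insert.2 hi)

lemma IsChoice.mem_exchangeable (h : IsChoice f (indepOracle Ms) S u ℓ (some x)) :
    x ∈ exchangeable (Ms ℓ) S.toFinset u :=
  ⟨by simpa using h.mem x rfl, indepOracle_insert_erase.1 (h.indep x rfl)⟩

lemma IsChoice.le_of_exchangeable (h : IsChoice f (indepOracle Ms) S u ℓ (some x)) {y : N}
    (hy : y ∈ exchangeable (Ms ℓ) S.toFinset u) : contribution f S x ≤ contribution f S y :=
  h.minimal x rfl y (by simpa using hy.1) (indepOracle_insert_erase.2 hy.2)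

lemma IsChoice.ne_none (h : IsChoice f (indepOracle Ms) S u ℓ o)
    (hd : ¬ (Ms ℓ).Indep (insert u (S.toFinset : Set N) ∩ (Ms ℓ).E))
    (hne : (exchangeable (Ms ℓ) S.toFinset u).Nonempty) : o ≠ none := by
  rintro rfl
  obtain ⟨y, hy⟩ := hne
  have h0 := Bool.eq_false_iff.2 (mt indepOracle_insert.1 hd)
  have h1 := h.empty h0 rfl y (by simpa using hy.1)
  rw [indepOracle_insert_erase.2 hy.2] at h1
  simp at h1

end

/-- The invariants of a run.  The elements of `P` have arrived, those of `A` have been accepted at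
some point, and those of `R` would have been rejected even if sampled.  For `x ∈ A`, the value
`v x` is `f(x : S)` for the last solution `S` that contained `x`, and `leaf ℓ` consists of the
elements of `A` that have not been exchanged on account of the `ℓ`-th matroid.  The number `g x` is
the marginal contribution of `x` on arrival, and `w ℓ x` is the amount that `x` charges to
`leaf ℓ`. -/
structure RunInvariant (f : Finset N → ℝ) (Ms : Fin m → Matroid N) (c : ℝ) (g : N → ℝ)
    (S : List N) (P A R : Finset N) (leaf : Fin m → Finset N) (v : N → ℝ) (w : Fin m → N → ℝ) :
    Prop where
  nodup : S.Nodup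
  subset : ∀ x ∈ S, x ∈ A
  accepted_subset : A ⊆ P
  rejected_subset : R ⊆ P
  disjoint : Disjoint A R
  feasible : Feasible Ms S.toFinset
  v_eq : ∀ x ∈ S, v x = contribution f S x
  v_nonneg : ∀ x ∈ A, 0 ≤ v x
  leaf_subset : ∀ ℓ, leaf ℓ ⊆ A
  mem_leaf : ∀ ℓ, ∀ x ∈ S, x ∈ leaf ℓ
  exchanged : ∀ x ∈ A, x ∉ S → ∃ ℓ, x ∈ (Ms ℓ).E ∧ x ∉ leaf ℓ
  loss_le : c * ∑ x ∈ A \ S.toFinset, v x ≤ f S.toFinset - f ∅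
  accepted_le : f A ≤ f S.toFinset + ∑ x ∈ A \ S.toFinset, v x
  w_nonneg : ∀ ℓ x, 0 ≤ w ℓ x
  span : ∀ ℓ x t, 0 < t → t ≤ w ℓ x → x ∈ (Ms ℓ).closure {y | y ∈ leaf ℓ ∧ t ≤ v y}
  gain_le_w : ∀ x ∈ A, ∀ ℓ, x ∈ (Ms ℓ).E → g x ≤ w ℓ x
  gain_le_v : ∀ x ∈ A, g x ≤ v x
  gain_le_sum : ∀ x ∈ R, Feasible Ms {x} → g x ≤ (1 + c) * ∑ ℓ, w ℓ x
  marginal_le : ∀ x ∈ P, x ∉ A → f (insert x A) - f A ≤ g x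

section

variable {g : N → ℝ} {S : List N} {P A R : Finset N} {leaf : Fin m → Finset N} {v : N → ℝ}
  {w : Fin m → N → ℝ} {u : N} {xs : Fin m → Option N}

lemma RunInvariant.init (f : Finset N → ℝ) (Ms : Fin m → Matroid N) (c : ℝ) (g : N → ℝ) :
    RunInvariant f Ms c g [] ∅ ∅ ∅ (fun _ => ∅) (fun _ => 0) (fun _ _ => 0) := by
  constructor <;> simp [Feasible]
  intro _ _ _ h1 h2
  linarith

lemma RunInvariant.marginal_insert (h : RunInvariant f Ms c g S P A R leaf v w)
    (hf : Submodular f) (hg : g u = f (insert u S.toFinset) - f S.toFinset) (x : N)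
    (hx : x ∈ insert u P) (hxA : x ∉ A) : f (insert x A) - f A ≤ g x := by
  rcases Finset.mem_insert.1 hx with rfl | hx
  · rw [hg]
    exact hf.marginal_le (fun y hy => h.subset y (List.mem_toFinset.1 hy)) hxA
  · exact h.marginal_le x hx hxA

lemma RunInvariant.skip (h : RunInvariant f Ms c g S P A R leaf v w) (hf : Submodular f)
    (hg : g u = f (insert u S.toFinset) - f S.toFinset) :
    RunInvariant f Ms c g S (insert u P) A R leaf v w :=
  { h with
    accepted_subset := h.accepted_subset.trans (Finset.subset_insert _ _)
    rejected_subset := h.rejected_subset.trans (Finset.subset_insert _ _)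
    marginal_le := h.marginal_insert hf hg }

lemma RunInvariant.contribution_nonneg (h : RunInvariant f Ms c g S P A R leaf v w) {x : N}
    (hx : x ∈ S) : 0 ≤ contribution f S x :=
  h.v_eq x hx ▸ h.v_nonneg x (h.subset x hx)

/-- The treatment of an element that is rejected, or that would be rejected if it were sampled. -/
lemma RunInvariant.reject (h : RunInvariant f Ms c g S P A R leaf v w) (hf : Submodular f)
    (hc : 0 < c) (hg : g u = f (insert u S.toFinset) - f S.toFinset) (hu : u ∉ P)
    (hxs : ∀ ℓ, IsChoice f (indepOracle Ms) S u ℓ (xs ℓ))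
    (hrej : ¬ ((∀ ℓ, indepOracle Ms ℓ (insert u S.toFinset) = false → xs ℓ ≠ none) ∧
      (1 + c) * ∑ x ∈ exchangeSet xs, contribution f S x ≤
        f (insert u S.toFinset) - f S.toFinset)) :
    ∃ w', RunInvariant f Ms c g S (insert u P) A (insert u R) leaf v w' := by
  -- The charge of `u` to matroid `ℓ` is the value of the minimizer. The default `0` is harmless:
  -- spans are required only for positive thresholds.
  set z : Fin m → ℝ := fun ℓ => (xs ℓ).elim 0 (contribution f S) with hz
  have hz0 : ∀ ℓ, 0 ≤ z ℓ := by
    intro ℓ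
    rcases hx : xs ℓ with _ | x
    · simp [hz, hx]
    · simpa [hz, hx] using h.contribution_nonneg ((hxs ℓ).mem x hx)
  have hne : ∀ x, x ≠ u → ∀ ℓ, Function.update (w ℓ) u (z ℓ) x = w ℓ x := fun x hx ℓ =>
    Function.update_of_ne hx _ _
  refine ⟨fun ℓ => Function.update (w ℓ) u (z ℓ), { h with
    accepted_subset := h.accepted_subset.trans (Finset.subset_insert _ _)
    rejected_subset := Finset.insert_subset_insert _ h.rejected_subset
    marginal_le := h.marginal_insert hf hg
    disjoint := ?_
    w_nonneg := ?_
    span := ?_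
    gain_le_w := ?_
    gain_le_sum := ?_ }⟩
  · rw [Finset.disjoint_insert_right]
    exact ⟨fun hA => hu (h.accepted_subset hA), h.disjoint⟩
  · intro ℓ x
    by_cases hx : x = u
    · subst hx
      simpa using hz0 ℓ
    · rw [hne x hx]
      exact h.w_nonneg ℓ x
  · intro ℓ x t ht htw
    by_cases hx : x = u
    · subst hx
      rw [Function.update_self] at htw
      rcases ho : xs ℓ with _ | y
      · simp only [hz, ho, Option.elim] at htw
        linarith
      · simp only [hz, ho, Option.elim] at htw
        have hch := hxs ℓ
        rw [ho] at hch
        -- The rest of the circuit spans the new element, and by minimality all of it has value at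
        -- least that of the chosen `y`.
        refine (Ms ℓ).closure_subset_closure ?_
          (mem_closure_exchangeable (h.feasible ℓ) hch.dependent)
        intro a ha
        have haS : a ∈ S := by simpa using ha.1
        refine ⟨h.mem_leaf ℓ a haS, ?_⟩
        rw [h.v_eq a haS]
        exact htw.trans (hch.le_of_exchangeable ha)
    · rw [hne x hx] at htw
      exact h.span ℓ x t ht htw
  · intro x hx ℓ hxE
    rw [hne x (fun hxu => hu (hxu ▸ h.accepted_subset hx))]
    exact h.gain_le_w x hx ℓ hxE
  · intro x hx hfeas
    by_cases hxu : x = u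
    · subst hxu
      simp only [Function.update_self]
      -- A feasible singleton is a loop in no matroid, so every required choice exists and the
      -- rejection is due to the values.
      have hvalid : ∀ ℓ, indepOracle Ms ℓ (insert x S.toFinset) = false → xs ℓ ≠ none := by
        intro ℓ hℓ
        have hd : ¬ (Ms ℓ).Indep (insert x (S.toFinset : Set N) ∩ (Ms ℓ).E) := fun hi => by
          rw [indepOracle_insert.2 hi] at hℓ
          simp at hℓ
        exact (hxs ℓ).ne_none hd
          (exchangeable_nonempty (h.feasible ℓ) hd (by simpa using hfeas ℓ))
      have hlt := not_le.1 fun hle => hrej ⟨hvalid, hle⟩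
      rw [hg]
      refine hlt.le.trans (mul_le_mul_of_nonneg_left ?_ (by linarith))
      -- An element chosen for several matroids counts once on the left and once per matroid on the
      -- right; contributions are nonnegative.
      have hsum : ∑ y ∈ exchangeSet xs, contribution f S y ≤
          ∑ ℓ, ∑ y ∈ (xs ℓ).toFinset, contribution f S y := by
        rw [Finset.sum_sigma']
        rw [← Finset.sum_fiberwise_of_maps_to (s := Finset.univ.sigma fun ℓ => (xs ℓ).toFinset)
          (t := exchangeSet xs) (g := fun i => i.2)
          (fun i hi => mem_exchangeSet.2 ⟨i.1, by simpa using hi⟩)]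
        refine Finset.sum_le_sum fun y hy => ?_
        obtain ⟨ℓ, hℓ⟩ := mem_exchangeSet.1 hy
        refine Finset.single_le_sum (f := fun i : (_ : Fin m) × N => contribution f S i.2)
          (a := ⟨ℓ, y⟩) ?_ (by simp [hℓ])
        rintro ⟨ℓ', y'⟩ hy'
        simp only [Finset.mem_filter, Finset.mem_sigma, Finset.mem_univ, true_and,
          Option.mem_toFinset, Option.mem_def] at hy'
        exact h.contribution_nonneg ((hxs ℓ').mem y' hy'.1)
      refine hsum.trans_eq (Finset.sum_congr rfl fun ℓ _ => ?_)
      rcases ho : xs ℓ with _ | y <;> simp [hz, ho]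
    · simp only [hne x hxu]
      exact h.gain_le_sum x ((Finset.mem_insert.1 hx).resolve_left hxu) hfeas

/-- The treatment of an element that is accepted. -/
lemma RunInvariant.accept (h : RunInvariant f Ms c g S P A R leaf v w) (hf : Submodular f)
    (hc : 0 < c) (hg : g u = f (insert u S.toFinset) - f S.toFinset) (hu : u ∉ P)
    (hxs : ∀ ℓ, IsChoice f (indepOracle Ms) S u ℓ (xs ℓ))
    (hvalid : ∀ ℓ, indepOracle Ms ℓ (insert u S.toFinset) = false → xs ℓ ≠ none)
    (hgain : (1 + c) * ∑ x ∈ exchangeSet xs, contribution f S x ≤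
        f (insert u S.toFinset) - f S.toFinset) :
    ∃ leaf' v' w', RunInvariant f Ms c g
      (S.filter (fun x => decide (x ∉ exchangeSet xs)) ++ [u]) (insert u P) (insert u A) R
      leaf' v' w' := by
  have huA : u ∉ A := fun hA => hu (h.accepted_subset hA)
  have huS : u ∉ S := fun hS => huA (h.subset u hS)
  have hUS : ∀ x ∈ exchangeSet xs, x ∈ S := fun x hx => by
    obtain ⟨ℓ, hℓ⟩ := mem_exchangeSet.1 hx
    exact (hxs ℓ).mem x hℓ
  set T := S.filter (fun x => decide (x ∉ exchangeSet xs)) with hT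
  set S' := T ++ [u] with hS'
  set loss := ∑ x ∈ exchangeSet xs, contribution f S x with hloss
  rw [← hg] at hgain
  have hmemT : ∀ x, x ∈ T ↔ x ∈ S ∧ x ∉ exchangeSet xs := fun x => by simp [hT]
  have hmemS' : ∀ x, x ∈ S' ↔ (x ∈ S ∧ x ∉ exchangeSet xs) ∨ x = u := fun x => by
    rw [hS', List.mem_append, hmemT, List.mem_singleton]
  have huT : u ∉ T := fun h' => huS ((hmemT u).1 h').1
  have hTS : T.toFinset ⊆ S.toFinset := fun x hx => by
    rw [List.mem_toFinset] at hx ⊢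
    exact ((hmemT x).1 hx).1
  have hS'fin : S'.toFinset = insert u T.toFinset := by ext; simp [hS']
  have hloss_nonneg : 0 ≤ loss := Finset.sum_nonneg fun x hx => h.contribution_nonneg (hUS x hx)
  have hg_nonneg : 0 ≤ g u := le_trans (by positivity) hgain
  have hloss_le : ∀ x ∈ exchangeSet xs, contribution f S x ≤ loss := fun x hx =>
    Finset.single_le_sum (f := contribution f S)
      (fun y hy => h.contribution_nonneg (hUS y hy)) hx
  have hgu : g u ≤ contribution f S' u := by
    rw [hg, hS', contribution_append_self huT]
    exact hf.marginal_le hTS (by simpa using huS)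
  have hgrow : ∀ x ∈ T, contribution f S x ≤ contribution f S' x := by
    intro x hx
    rw [hS', contribution_append_of_mem hx]
    exact hf.contribution_le_filter _ hx
  -- Values are updated while an element is held and frozen once it has left; hence they never
  -- decrease.
  set v' : N → ℝ := fun x => if x ∈ S' then contribution f S' x else v x with hv'
  have hv'u : v' u = contribution f S' u := if_pos ((hmemS' u).2 (Or.inr rfl))
  have hvv' : ∀ x ∈ A, v x ≤ v' x := by
    intro x hx
    by_cases hxS' : x ∈ S'
    · have hxT : x ∈ T := by
        rw [hS', List.mem_append, List.mem_singleton] at hxS'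
        exact hxS'.resolve_right fun hxu => huA (hxu ▸ hx)
      rw [hv', h.v_eq x ((hmemT x).1 hxT).1]
      simp only [if_pos hxS']
      exact hgrow x hxT
    · simp [hv', if_neg hxS']
  have hsdiff : insert u A \ S'.toFinset = A \ S.toFinset ∪ exchangeSet xs := by
    ext x
    simp only [Finset.mem_sdiff, Finset.mem_insert, List.mem_toFinset, hmemS', Finset.mem_union]
    constructor
    · rintro ⟨h1, h2⟩
      push Not at h2
      have h3 := h1.resolve_left h2.2
      by_cases hxS : x ∈ S
      · exact Or.inr (h2.1 hxS)
      · exact Or.inl ⟨h3, hxS⟩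
    · rintro (⟨h1, h2⟩ | h1)
      · exact ⟨Or.inr h1, fun h3 => h3.elim (fun h4 => h2 h4.1) fun h4 => huA (h4 ▸ h1)⟩
      · have h2 := hUS x h1
        exact ⟨Or.inr (h.subset x h2), fun h3 => h3.elim (fun h4 => h4.2 h1)
          fun h4 => huS (h4 ▸ h2)⟩
  have hsum : ∑ x ∈ insert u A \ S'.toFinset, v' x = ∑ x ∈ A \ S.toFinset, v x + loss := by
    have h1 : ∑ x ∈ insert u A \ S'.toFinset, v' x = ∑ x ∈ insert u A \ S'.toFinset, v x :=
      Finset.sum_congr rfl fun x hx => by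
        rw [Finset.mem_sdiff, List.mem_toFinset] at hx
        simp [hv', hx.2]
    rw [h1, hsdiff, Finset.sum_union]
    · exact congrArg _ (Finset.sum_congr rfl fun x hx => h.v_eq x (hUS x hx))
    · rw [Finset.disjoint_left]
      intro x hx hx'
      exact (Finset.mem_sdiff.1 hx).2 (List.mem_toFinset.2 (hUS x hx'))
  have hfS' : f S.toFinset + g u - loss ≤ f S'.toFinset := by
    have h1 := hf.sub_filter_le h.nodup (exchangeSet xs)
    rw [Finset.inter_eq_right.2 fun x hx => List.mem_toFinset.2 (hUS x hx)] at h1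
    rw [hS', contribution_append_self huT] at hgu
    rw [hS'fin]
    linarith
  set leaf' : Fin m → Finset N := fun ℓ => insert u (leaf ℓ \ (xs ℓ).toFinset) with hleaf'
  have hleaf_mem : ∀ ℓ, ∀ x ∈ leaf ℓ, xs ℓ ≠ some x → x ∈ leaf' ℓ := fun ℓ x hx hne => by
    simp [hleaf', hx, hne]
  have hne : ∀ x, x ≠ u → ∀ ℓ,
      Function.update (w ℓ) u ((Ms ℓ).E.indicator (fun _ => g u) u) x = w ℓ x :=
    fun x hx ℓ => Function.update_of_ne hx _ _
  have hneA : ∀ x ∈ A, x ≠ u := fun x hx hxu => huA (hxu ▸ hx)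
  -- An accepted `u` charges its gain to each matroid containing it, where it is a leaf of value at
  -- least `g u`, and charges `0` elsewhere.
  refine ⟨leaf', v', fun ℓ => Function.update (w ℓ) u ((Ms ℓ).E.indicator (fun _ => g u) u), ?_⟩
  constructor
  · rw [hS', ← List.concat_eq_append]
    exact (h.nodup.filter _).concat huT
  · intro x hx
    rcases (hmemS' x).1 hx with h1 | rfl
    · exact Finset.mem_insert_of_mem (h.subset x h1.1)
    · exact Finset.mem_insert_self _ _
  · exact Finset.insert_subset_insert _ h.accepted_subset
  · exact h.rejected_subset.trans (Finset.subset_insert _ _)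
  · rw [Finset.disjoint_insert_left]
    exact ⟨fun hR => hu (h.rejected_subset hR), h.disjoint⟩
  · intro ℓ
    by_cases hi : (Ms ℓ).Indep (insert u (S.toFinset : Set N) ∩ (Ms ℓ).E)
    · refine hi.subset (Set.inter_subset_inter_left _ ?_)
      rw [hS'fin, Finset.coe_insert]
      exact Set.insert_subset_insert (by exact_mod_cast hTS)
    · obtain ⟨x, hx⟩ := Option.ne_none_iff_exists'.1
        (hvalid ℓ (by simpa using mt indepOracle_insert.1 hi))
      have hch := hxs ℓ
      rw [hx] at hch
      refine hch.mem_exchangeable.2.subset (Set.inter_subset_inter_left _ ?_)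
      rw [hS'fin, Finset.coe_insert]
      refine Set.insert_subset_insert fun y hy => ?_
      have hy' : y ∈ T := by simpa using hy
      rw [hmemT] at hy'
      refine ⟨by simpa using hy'.1, ?_⟩
      rintro rfl
      exact hy'.2 (mem_exchangeSet.2 ⟨ℓ, hx⟩)
  · intro x hx
    simp [hv', hx]
  · intro x hx
    rcases Finset.mem_insert.1 hx with rfl | hx
    · rw [hv'u]
      exact hg_nonneg.trans hgu
    · exact (h.v_nonneg x hx).trans (hvv' x hx)
  · intro ℓ
    exact Finset.insert_subset_insert _ (Finset.sdiff_subset.trans (h.leaf_subset ℓ))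
  · intro ℓ x hx
    rcases (hmemS' x).1 hx with h1 | rfl
    · exact hleaf_mem ℓ x (h.mem_leaf ℓ x h1.1) fun h2 => h1.2 (mem_exchangeSet.2 ⟨ℓ, h2⟩)
    · exact Finset.mem_insert_self _ _
  · intro x hx hxS'
    have hxu : x ≠ u := fun hxu => hxS' ((hmemS' x).2 (Or.inr hxu))
    have hxA := (Finset.mem_insert.1 hx).resolve_left hxu
    by_cases hxS : x ∈ S
    · have hxU : x ∈ exchangeSet xs := by
        by_contra hxU
        exact hxS' ((hmemS' x).2 (Or.inl ⟨hxS, hxU⟩))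
      obtain ⟨ℓ, hℓ⟩ := mem_exchangeSet.1 hxU
      have hch := hxs ℓ
      rw [hℓ] at hch
      exact ⟨ℓ, exchangeable_subset_ground (h.feasible ℓ) hch.dependent hch.mem_exchangeable,
        by simp [hleaf', hℓ, hxu]⟩
    · obtain ⟨ℓ, h1, h2⟩ := h.exchanged x hxA hxS
      exact ⟨ℓ, h1, by simp [hleaf', h2, hxu]⟩
  -- The solution gains at least `g u - loss ≥ c * loss`, while the removed value grows by `loss`.
  · rw [hsum]
    linarith [h.loss_le]
  · rw [hsum]
    have h1 := h.marginal_insert hf hg u (Finset.mem_insert_self _ _) huA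
    linarith [h.accepted_le]
  · intro ℓ x
    by_cases hx : x = u
    · subst hx
      rw [Function.update_self]
      exact Set.indicator_nonneg (fun _ _ => hg_nonneg) _
    · rw [hne x hx]
      exact h.w_nonneg ℓ x
  · intro ℓ x t ht htw
    by_cases hx : x = u
    · subst hx
      rw [Function.update_self] at htw
      by_cases hE : x ∈ (Ms ℓ).E
      · rw [Set.indicator_of_mem hE] at htw
        exact (Ms ℓ).mem_closure_of_mem' ⟨Finset.mem_insert_self _ _,
          htw.trans (hv'u ▸ hgu)⟩ hE
      · rw [Set.indicator_of_notMem hE] at htw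
        linarith
    · rw [hne x hx] at htw
      have h1 := h.span ℓ x t ht htw
      rw [← Matroid.closure_inter_ground] at h1
      -- It suffices to span each old leaf of value at least `t`. The only one lost is the chosen
      -- `y`, which the rest of its circuit spans.
      refine (Ms ℓ).closure_subset_closure_of_subset_closure ?_ h1
      rintro y ⟨⟨hy, hty⟩, hyE⟩
      by_cases hys : xs ℓ = some y
      · have hch := hxs ℓ
        rw [hys] at hch
        have hyS := (hxs ℓ).mem y hys
        rw [h.v_eq y hyS] at hty
        refine (Ms ℓ).closure_subset_closure ?_
          (mem_closure_of_exchangeable (h.feasible ℓ) hch.dependent hch.mem_exchangeable)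
        rintro a ⟨ha, hay⟩
        rcases ha with rfl | ha
        · refine ⟨Finset.mem_insert_self _ _, ?_⟩
          have h2 := hloss_le y (mem_exchangeSet.2 ⟨ℓ, hys⟩)
          rw [hv'u]
          -- `t ≤ f(y : S) ≤ loss ≤ (1 + c) * loss ≤ g u ≤ f(u : S')`.
          nlinarith
        · have haS : a ∈ S := by simpa using ha.1
          refine ⟨hleaf_mem ℓ a (h.mem_leaf ℓ a haS) fun h2 => hay ?_, ?_⟩
          · rw [hys] at h2
            exact (Option.some.inj h2).symm
          · refine le_trans ?_ (hvv' a (h.subset a haS))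
            rw [h.v_eq a haS]
            exact hty.trans (hch.le_of_exchangeable ha)
      · exact (Ms ℓ).mem_closure_of_mem' ⟨hleaf_mem ℓ y hy hys,
          hty.trans (hvv' y (h.leaf_subset ℓ hy))⟩ hyE
  · intro x hx ℓ hE
    by_cases hxu : x = u
    · subst hxu
      rw [Function.update_self, Set.indicator_of_mem hE]
    · rw [hne x hxu]
      exact h.gain_le_w x ((Finset.mem_insert.1 hx).resolve_left hxu) ℓ hE
  · intro x hx
    rcases Finset.mem_insert.1 hx with rfl | hx
    · rw [hv'u]
      exact hgu
    · exact (h.gain_le_v x hx).trans (hvv' x hx)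
  · intro x hx hfeas
    have hxu : x ≠ u := fun hxu => hu (hxu ▸ h.rejected_subset hx)
    simp only [hne x hxu]
    exact h.gain_le_sum x hx hfeas
  · intro x hx hxA
    rw [Finset.mem_insert, not_or] at hxA
    refine le_trans (hf.marginal_le (Finset.subset_insert _ _) ?_)
      (h.marginal_insert hf hg x hx hxA.2)
    simp [hxA]

/-- For each threshold, the elements of `OPT` with weight at least `t` are independent and lie in
the span of the leaves with value at least `t`, so there are no more of them. -/
lemma RunInvariant.sum_w_le (h : RunInvariant f Ms c g S P A R leaf v w) {OPT : Finset N}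
    (hO : Feasible Ms OPT) (ℓ : Fin m) [DecidablePred (· ∈ (Ms ℓ).E)] :
    ∑ x ∈ OPT, w ℓ x ≤ ∑ x ∈ (leaf ℓ).filter (· ∈ (Ms ℓ).E), v x := by
  refine sum_le_sum_of_card_threshold_le _ _ _ _
    (fun x hx => h.v_nonneg x (h.leaf_subset ℓ (Finset.mem_filter.1 hx).1)) fun t ht => ?_
  have hsub : ((OPT.filter fun x => t ≤ w ℓ x : Finset N) : Set N) ⊆
      (Ms ℓ).closure {y | y ∈ leaf ℓ ∧ t ≤ v y} := fun x hx =>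
    h.span ℓ x t ht (Finset.mem_filter.1 hx).2
  refine card_le_card_of_indep_of_subset_closure (M := Ms ℓ) ((hO ℓ).subset fun x hx => ?_)
    (hsub.trans ?_)
  · exact ⟨(Finset.mem_filter.1 hx).1, (Ms ℓ).closure_subset_ground _ (hsub hx)⟩
  · rw [← Matroid.closure_inter_ground]
    refine (Ms ℓ).closure_subset_closure ?_
    rintro y ⟨⟨h1, h2⟩, h3⟩
    simp [h1, h2, h3]

omit [DecidableEq N] in
lemma Feasible.subset {A B : Finset N} (h : Feasible Ms B) (hAB : A ⊆ B) : Feasible Ms A :=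
  fun ℓ => (h ℓ).subset (Set.inter_subset_inter_left _ (by exact_mod_cast hAB))

/-- All gains are paid by the leaves. The factor `(1 + c) p` on the accepted part is what the
sampling probability will later balance. -/
lemma RunInvariant.sum_gain_le (h : RunInvariant f Ms c g S P A R leaf v w) (hc : 0 < c) {p : ℕ}
    (hp : IsMatchoid p Ms) {OPT : Finset N} (hO : Feasible Ms OPT) :
    ∑ x ∈ OPT ∩ R, g x + (1 + c) * p * ∑ x ∈ OPT ∩ A, g x ≤
      (1 + c) * (p * (f S.toFinset - f ∅) + (p - 1) * ∑ x ∈ A \ S.toFinset, v x) := by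
  classical
  set k : N → ℝ := fun x => ((Finset.univ.filter fun ℓ => x ∈ (Ms ℓ).E).card : ℝ) with hk
  have hkp : ∀ x, k x ≤ p := fun x => by
    have h1 := hp x
    rw [Set.ncard_eq_toFinset_card'] at h1
    simp only [hk]
    refine le_trans (le_of_eq ?_) (Nat.cast_le.2 h1)
    congr 2
    ext
    simp
  have hR : ∑ x ∈ OPT ∩ R, g x ≤ (1 + c) * ∑ x ∈ OPT ∩ R, ∑ ℓ, w ℓ x := by
    rw [Finset.mul_sum]
    refine Finset.sum_le_sum fun x hx => h.gain_le_sum x (Finset.mem_inter.1 hx).2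
      (hO.subset (Finset.singleton_subset_iff.2 (Finset.mem_inter.1 hx).1))
  -- An accepted `x` charges only the `k x` matroids containing it; the missing `p - k x` copies of
  -- its gain are paid by `v x` directly.
  have hA : p * ∑ x ∈ OPT ∩ A, g x ≤
      ∑ x ∈ OPT ∩ A, ∑ ℓ, w ℓ x + ∑ x ∈ A, (p - k x) * v x := by
    have h1 : ∑ x ∈ OPT ∩ A, (p - k x) * v x ≤ ∑ x ∈ A, (p - k x) * v x :=
      Finset.sum_le_sum_of_subset_of_nonneg Finset.inter_subset_right fun x hx _ =>
        mul_nonneg (sub_nonneg.2 (hkp x)) (h.v_nonneg x hx)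
    refine le_trans ?_ (add_le_add_right h1 _)
    rw [Finset.mul_sum, ← Finset.sum_add_distrib]
    refine Finset.sum_le_sum fun x hx => ?_
    have hxA := (Finset.mem_inter.1 hx).2
    have h2 : k x * g x ≤ ∑ ℓ, w ℓ x := by
      rw [hk, ← nsmul_eq_mul, ← Finset.sum_const]
      refine le_trans (Finset.sum_le_sum fun ℓ hℓ => h.gain_le_w x hxA ℓ
        (Finset.mem_filter.1 hℓ).2) ?_
      exact Finset.sum_le_sum_of_subset_of_nonneg (Finset.filter_subset _ _)
        fun ℓ _ _ => h.w_nonneg ℓ x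
    have h3 := mul_le_mul_of_nonneg_left (h.gain_le_v x hxA) (sub_nonneg.2 (hkp x))
    linarith
  have hdisj : Disjoint (OPT ∩ R) (OPT ∩ A) :=
    Finset.disjoint_of_subset_left Finset.inter_subset_right
      (Finset.disjoint_of_subset_right Finset.inter_subset_right h.disjoint.symm)
  have hw : ∑ x ∈ OPT ∩ R, ∑ ℓ, w ℓ x + ∑ x ∈ OPT ∩ A, ∑ ℓ, w ℓ x ≤
      ∑ ℓ, ∑ x ∈ (leaf ℓ).filter (· ∈ (Ms ℓ).E), v x := by
    rw [← Finset.sum_union hdisj]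
    refine le_trans (Finset.sum_le_sum_of_subset_of_nonneg (t := OPT) ?_ ?_) ?_
    · exact Finset.union_subset Finset.inter_subset_left Finset.inter_subset_left
    · exact fun x _ _ => Finset.sum_nonneg fun ℓ _ => h.w_nonneg ℓ x
    · rw [Finset.sum_comm]
      exact Finset.sum_le_sum fun ℓ _ => h.sum_w_le hO ℓ
  have hleaf : ∑ ℓ, ∑ x ∈ (leaf ℓ).filter (· ∈ (Ms ℓ).E), v x =
      ∑ x ∈ A, ((Finset.univ.filter fun ℓ => x ∈ (Ms ℓ).E ∧ x ∈ leaf ℓ).card : ℝ) * v x := by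
    have h1 : ∀ ℓ, ∑ x ∈ (leaf ℓ).filter (· ∈ (Ms ℓ).E), v x =
        ∑ x ∈ A, if x ∈ (Ms ℓ).E ∧ x ∈ leaf ℓ then v x else 0 := by
      intro ℓ
      rw [← Finset.sum_filter]
      refine Finset.sum_congr ?_ fun _ _ => rfl
      ext x
      simp only [Finset.mem_filter]
      exact ⟨fun hx => ⟨h.leaf_subset ℓ hx.1, hx.2, hx.1⟩, fun hx => ⟨hx.2.2, hx.2.1⟩⟩
    rw [Finset.sum_congr rfl fun ℓ _ => h1 ℓ, Finset.sum_comm]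
    refine Finset.sum_congr rfl fun x _ => ?_
    rw [← Finset.sum_filter, Finset.sum_const, nsmul_eq_mul]
  -- With the padding, held elements are counted at most `p` times and removed ones at most `p - 1`
  -- times, since a removed element has left the leaf set of a matroid that contains it.
  have hcount : ∑ x ∈ A,
        ((Finset.univ.filter fun ℓ => x ∈ (Ms ℓ).E ∧ x ∈ leaf ℓ).card : ℝ) * v x +
      ∑ x ∈ A, (p - k x) * v x ≤
      p * (f S.toFinset - f ∅) + (p - 1) * ∑ x ∈ A \ S.toFinset, v x := by
    have hSA : S.toFinset ⊆ A := fun x hx => h.subset x (List.mem_toFinset.1 hx)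
    rw [← sum_contribution f h.nodup, ← Finset.sum_add_distrib, ← Finset.sum_sdiff hSA,
      add_comm, Finset.mul_sum, Finset.mul_sum]
    refine add_le_add (Finset.sum_le_sum fun x hx => ?_) (Finset.sum_le_sum fun x hx => ?_)
    · have h0 := h.contribution_nonneg (List.mem_toFinset.1 hx)
      rw [h.v_eq x (List.mem_toFinset.1 hx), ← add_mul]
      refine mul_le_mul_of_nonneg_right ?_ h0
      have h1 : ((Finset.univ.filter fun ℓ => x ∈ (Ms ℓ).E ∧ x ∈ leaf ℓ).card : ℝ) ≤ k x :=
        Nat.cast_le.2 (Finset.card_le_card fun ℓ hℓ => by simp at hℓ ⊢; exact hℓ.1)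
      linarith
    · rw [Finset.mem_sdiff, List.mem_toFinset] at hx
      rw [← add_mul]
      refine mul_le_mul_of_nonneg_right ?_ (h.v_nonneg x hx.1)
      obtain ⟨ℓ₀, h1, h2⟩ := h.exchanged x hx.1 hx.2
      have h3 : (Finset.univ.filter fun ℓ => x ∈ (Ms ℓ).E ∧ x ∈ leaf ℓ).card + 1 ≤
          (Finset.univ.filter fun ℓ => x ∈ (Ms ℓ).E).card := by
        refine Finset.card_lt_card ((Finset.ssubset_iff_of_subset fun ℓ hℓ => ?_).2
          ⟨ℓ₀, by simpa using h1, by simp [h2]⟩)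
        simp at hℓ ⊢
        exact hℓ.1
      have h4 : ((Finset.univ.filter fun ℓ => x ∈ (Ms ℓ).E ∧ x ∈ leaf ℓ).card : ℝ) + 1 ≤
          k x := by
        simp only [hk]
        exact_mod_cast h3
      linarith
  have h1c : 0 ≤ 1 + c := by linarith
  have h2 := mul_le_mul_of_nonneg_left hA h1c
  rw [hleaf] at hw
  have h3 := mul_le_mul_of_nonneg_left (add_le_add hw hcount) h1c
  linarith

lemma RunInvariant.union_le (h : RunInvariant f Ms c g S P A R leaf v w) (hf : Submodular f)
    (hc : 0 < c) {p : ℕ} (hp1 : 1 ≤ p) (hp : IsMatchoid p Ms) {OPT : Finset N}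
    (hO : Feasible Ms OPT) (hP : OPT ⊆ P) :
    f (OPT ∪ A) + (1 + c) * p * ∑ x ∈ OPT ∩ A, g x ≤
      f ∅ + (1 + c) ^ 2 * p / c * (f S.toFinset - f ∅) + ∑ x ∈ OPT \ (A ∪ R), g x := by
  have h1 := hf.union_le A OPT
  have h2 : ∑ x ∈ OPT \ A, (f (insert x A) - f A) ≤ ∑ x ∈ OPT \ A, g x :=
    Finset.sum_le_sum fun x hx => by
      rw [Finset.mem_sdiff] at hx
      exact h.marginal_le x (hP hx.1) hx.2
  have h3 : OPT \ A = (OPT ∩ R) ∪ (OPT \ (A ∪ R)) := by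
    ext x
    have hd : x ∈ A → x ∉ R := fun hx => Finset.disjoint_left.1 h.disjoint hx
    simp only [Finset.mem_sdiff, Finset.mem_union, Finset.mem_inter]
    tauto
  have h4 : Disjoint (OPT ∩ R) (OPT \ (A ∪ R)) := by
    rw [Finset.disjoint_left]
    intro x hx hx'
    simp only [Finset.mem_sdiff, Finset.mem_union, Finset.mem_inter] at hx hx'
    tauto
  rw [h3, Finset.sum_union h4, Finset.sum_union h4] at h2
  have h5 := h.sum_gain_le hc hp hO
  have h6 := h.loss_le
  have h7 := h.accepted_le
  set F := f S.toFinset - f ∅ with hF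
  set L := ∑ x ∈ A \ S.toFinset, v x with hL
  have hp' : (1 : ℝ) ≤ p := by exact_mod_cast hp1
  have h8 : L ≤ F / c := by
    rw [le_div_iff₀ hc]
    linarith
  -- The total coefficient of `L` is `1 + (1 + c)(p - 1) = (1 + c) p - c`, which is nonnegative
  -- because `p ≥ 1`.
  have h9 : L * ((1 + c) * p - c) ≤ F / c * ((1 + c) * p - c) := by
    refine mul_le_mul_of_nonneg_right h8 ?_
    nlinarith
  have h10 : (1 + c) ^ 2 * p / c * F = F + (1 + c) * p * F + F / c * ((1 + c) * p - c) := by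
    field_simp
    ring
  rw [h10]
  have h11 : (1 + c) * (p * F + (p - 1) * L) = (1 + c) * p * F + L * ((1 + c) * p - c) - L := by
    ring
  rw [h11] at h5
  rw [h3, Finset.sum_union h4] at h1
  linarith

end

end Run

/-! ### Expectations over the coin tosses -/

section Expectation

variable {n : ℕ} {q : ℝ}

lemma expectation_mono (h0 : 0 ≤ q) (h1 : q ≤ 1) {g h : (Fin n → Bool) → ℝ}
    (hgh : ∀ ω, g ω ≤ h ω) : expectation q g ≤ expectation q h :=
  Finset.sum_le_sum fun ω _ => mul_le_mul_of_nonneg_left (hgh ω) <|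
    Finset.prod_nonneg fun i _ => by split_ifs <;> linarith

lemma expectation_add (g h : (Fin n → Bool) → ℝ) :
    expectation q (fun ω => g ω + h ω) = expectation q g + expectation q h := by
  simp only [expectation, mul_add, Finset.sum_add_distrib]

lemma expectation_mul_left (a : ℝ) (g : (Fin n → Bool) → ℝ) :
    expectation q (fun ω => a * g ω) = a * expectation q g := by
  simp only [expectation, Finset.mul_sum, mul_left_comm]

lemma expectation_mul_right (a : ℝ) (g : (Fin n → Bool) → ℝ) :
    expectation q (fun ω => g ω * a) = expectation q g * a := by
  simp only [expectation, Finset.sum_mul, mul_assoc]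

lemma expectation_sum {ι : Type*} (s : Finset ι) (g : ι → (Fin n → Bool) → ℝ) :
    expectation q (fun ω => ∑ i ∈ s, g i ω) = ∑ i ∈ s, expectation q (g i) := by
  simp only [expectation, Finset.mul_sum]
  exact Finset.sum_comm

lemma expectation_const (q a : ℝ) : expectation q (fun _ : Fin n → Bool => a) = a := by
  have h := Finset.prod_univ_sum (fun _ : Fin n => (Finset.univ : Finset Bool))
    (fun _ b => if b then q else 1 - q)
  simp only [Fintype.piFinset_univ, Fintype.sum_bool, if_true, Bool.false_eq_true, if_false,
    add_sub_cancel, Finset.prod_const_one] at h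
  rw [expectation, ← Finset.sum_mul, ← h, one_mul]

/-- A quantity that does not depend on the `i`-th toss. -/
lemma expectation_toss (i : Fin n) (G : (Fin n → Bool) → ℝ)
    (hG : ∀ ω b, G (Function.update ω i b) = G ω) :
    q * expectation q (fun ω => if ω i then 0 else G ω) =
      (1 - q) * expectation q (fun ω => if ω i then G ω else 0) := by
  -- Flipping the `i`-th toss swaps the two events, keeps `G`, and exchanges the factors `q` and `1
  -- - q`.
  have hinv : Function.Involutive fun ω : Fin n → Bool => Function.update ω i (!ω i) := by
    intro ω
    simp
  unfold expectation
  rw [Finset.mul_sum, Finset.mul_sum, ← Equiv.sum_comp hinv.toPerm]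
  refine Finset.sum_congr rfl fun ω _ => ?_
  have h1 : ∏ j ∈ Finset.univ.erase i, (if Function.update ω i (!ω i) j then q else 1 - q) =
      ∏ j ∈ Finset.univ.erase i, (if ω j then q else 1 - q) :=
    Finset.prod_congr rfl fun j hj => by
      rw [Function.update_of_ne (Finset.ne_of_mem_erase hj)]
  change q * ((∏ j, if Function.update ω i (!ω i) j then q else 1 - q) *
    if Function.update ω i (!ω i) i then 0 else G (Function.update ω i (!ω i))) = _
  rw [hG, ← Finset.mul_prod_erase _ _ (Finset.mem_univ i), h1,
    ← Finset.mul_prod_erase _ (fun j => if ω j then q else 1 - q) (Finset.mem_univ i),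
    Function.update_self]
  rcases hω : ω i with _ | _
  · simp [hω]
  · simp [hω]
    ring

lemma expectation_toss_true (i : Fin n) :
    expectation q (fun ω => if ω i then (1 : ℝ) else 0) = q := by
  have h1 := expectation_toss (q := q) i (fun _ => 1) fun _ _ => rfl
  have h2 : expectation q (fun ω : Fin n → Bool => if ω i then (0 : ℝ) else 1) +
      expectation q (fun ω => if ω i then (1 : ℝ) else 0) = 1 := by
    rw [← expectation_add]
    refine Eq.trans ?_ (expectation_const (n := n) q 1)
    congr 1
    ext ω
    split_ifs <;> simp
  linear_combination q * h2 - h1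

/-- If a random set contains every element with probability at most `q`, then the expected value
of a nonnegative submodular function is at least `1 - q` times its value at the empty set. -/
lemma Submodular.le_expectation {N : Type u} [Fintype N] [DecidableEq N] {g : Finset N → ℝ}
    (hg : Submodular g) (hg0 : ∀ A, 0 ≤ g A) (h0 : 0 ≤ q) (h1 : q ≤ 1)
    (A : (Fin n → Bool) → Finset N)
    (hA : ∀ x, expectation q (fun ω => if x ∈ A ω then (1 : ℝ) else 0) ≤ q) :
    (1 - q) * g ∅ ≤ expectation q (fun ω => g (A ω)) := by
  set P : N → ℝ := fun x => expectation q (fun ω => if x ∈ A ω then (1 : ℝ) else 0) with hP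
  have hP0 : ∀ x, 0 ≤ P x := fun x => by
    rw [← expectation_const (n := n) q 0]
    exact expectation_mono h0 h1 fun ω => by split_ifs <;> norm_num
  -- Elements are added by decreasing probability. Adding `a` contributes at least `P a * (g (B + a)
  -- - g B)`; the induction hypothesis at `r = P a` supplies the `P a * g B` that this uses up.
  have key : ∀ B : Finset N, ∀ r, 0 ≤ r → r ≤ q → (∀ x ∈ B, r ≤ P x) →
      (1 - q) * g ∅ + r * g B ≤ expectation q (fun ω => g (A ω ∩ B)) := by
    intro B
    induction B using Finset.induction_on_min_value P with
    | empty =>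
      intro r _ hr _
      simp only [Finset.inter_empty, expectation_const]
      nlinarith [hg0 ∅]
    | insert a B ha hmin ih =>
      intro r hr0 hrq hr
      have h2 := ih (P a) (hP0 a) (hA a) hmin
      have h3 : P a * (g (insert a B) - g B) + expectation q (fun ω => g (A ω ∩ B)) ≤
          expectation q (fun ω => g (A ω ∩ insert a B)) := by
        rw [hP]
        simp only
        rw [← expectation_mul_right, ← expectation_add]
        refine expectation_mono h0 h1 fun ω => ?_
        by_cases haA : a ∈ A ω
        · rw [if_pos haA, one_mul, Finset.inter_insert_of_mem haA]
          have := hg.marginal_le (x := a) (A := A ω ∩ B) Finset.inter_subset_right ha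
          linarith
        · rw [if_neg haA, Finset.inter_insert_of_notMem haA]
          simp
      have h4 := mul_le_mul_of_nonneg_right (hr a (Finset.mem_insert_self _ _))
        (hg0 (insert a B))
      linarith
  simpa using key Finset.univ 0 le_rfl h0 fun x _ => hP0 x

end Expectation

/-! ### The run of the algorithm -/

section Algorithm

variable {N : Type u} [DecidableEq N] {n m : ℕ} {f : Finset N → ℝ}

/-- The algorithm does not look ahead: the solution facing the `j`-th element is independent of its
toss. -/
lemma solution_update {I : Fin m → Finset N → Bool} {c : ℝ} {tie : TieRule N m}
    {stream : Fin n ≃ N} (ω : Fin n → Bool) (j : Fin n) (b : Bool) :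
    ∀ i : ℕ, i ≤ j → solution f I c tie stream (Function.update ω j b) i =
      solution f I c tie stream ω i
  | 0, _ => rfl
  | i + 1, hi => by
    have hin : i < n := by omega
    have hne : (⟨i, hin⟩ : Fin n) ≠ j := fun h => by
      rw [← h] at hi
      simp at hi
    rw [solution, solution, dif_pos hin, dif_pos hin, Function.update_of_ne hne,
      solution_update ω j b i (by omega)]

variable (f) (Ms : Fin m → Matroid N) (c : ℝ) (tie : TieRule N m) (stream : Fin n ≃ N)

/-- The choices that Exchange-Candidate makes for the solution `S` and the arriving element `u`. -/
def choices (S : List N) (u : N) : Fin m → Option N :=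
  Classical.choose (exec_considerElement (f := f) (I := indepOracle Ms) c tie S u).1

lemma isChoice_choices (S : List N) (u : N) (ℓ : Fin m) :
    IsChoice f (indepOracle Ms) S u ℓ (choices f Ms c tie S u ℓ) :=
  (Classical.choose_spec (exec_considerElement (f := f) (I := indepOracle Ms) c tie S u).1).1 ℓ

/-- Whether `u` is accepted if it is sampled when the solution is `S`. -/
def Accepts (S : List N) (u : N) : Prop :=
  (∀ ℓ, indepOracle Ms ℓ (insert u S.toFinset) = false → choices f Ms c tie S u ℓ ≠ none) ∧
    (1 + c) * ∑ x ∈ exchangeSet (choices f Ms c tie S u), contribution f S x ≤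
      f (insert u S.toFinset) - f S.toFinset

lemma arrive_of_accepts {S : List N} {u : N} (h : Accepts f Ms c tie S u) :
    (arrive f (indepOracle Ms) c tie true S u).mem.S =
      S.filter (fun x => decide (x ∉ exchangeSet (choices f Ms c tie S u))) ++ [u] := by
  have h1 := (Classical.choose_spec
    (exec_considerElement (f := f) (I := indepOracle Ms) c tie S u).1).2
  rw [arrive, if_pos rfl, h1, exchangeStep, if_pos]
  · rfl
  · exact h

lemma arrive_of_not_accepts {S : List N} {u : N} (b : Bool) (h : ¬ Accepts f Ms c tie S u) :
    (arrive f (indepOracle Ms) c tie b S u).mem.S = S := by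
  rcases b with _ | _
  · rfl
  · have h1 := (Classical.choose_spec
      (exec_considerElement (f := f) (I := indepOracle Ms) c tie S u).1).2
    rw [arrive, if_pos rfl, h1, exchangeStep, if_neg]
    exact h

/-- The marginal contribution of `x` to the solution when it arrives. -/
def arrivalGain (ω : Fin n → Bool) (x : N) : ℝ :=
  f (insert x (solution f (indepOracle Ms) c tie stream ω (stream.symm x)).toFinset) -
    f (solution f (indepOracle Ms) c tie stream ω (stream.symm x)).toFinset

/-- The elements that arrive before time `i`. -/
def arrived [Fintype N] (i : ℕ) : Finset N :=
  Finset.univ.filter fun x => (stream.symm x : ℕ) < i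

-- The last clause describes `A` and `R` by the coin and by acceptance at the element's own arrival,
-- which is what the independence argument needs.
variable {f} {c} in
lemma exists_runInvariant [Fintype N] (hf : Submodular f) (hc : 0 < c) (ω : Fin n → Bool) :
    ∀ i ≤ n, ∃ A R leaf v w, RunInvariant f Ms c (arrivalGain f Ms c tie stream ω)
      (solution f (indepOracle Ms) c tie stream ω i) (arrived stream i) A R leaf v w ∧
      ∀ j : Fin n, (j : ℕ) < i →
        (stream j ∈ A ↔ ω j = true ∧ Accepts f Ms c tie
          (solution f (indepOracle Ms) c tie stream ω j) (stream j)) ∧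
        (stream j ∈ R ↔ ¬ Accepts f Ms c tie
          (solution f (indepOracle Ms) c tie stream ω j) (stream j)) := by
  intro i
  induction i with
  | zero =>
    intro _
    refine ⟨∅, ∅, fun _ => ∅, fun _ => 0, fun _ _ => 0, ?_, by simp⟩
    have h0 : arrived stream 0 = ∅ := by simp [arrived]
    rw [h0, solution]
    exact RunInvariant.init f Ms c _
  | succ i ih =>
    intro hi
    have hin : i < n := hi
    obtain ⟨A, R, leaf, v, w, h, hAR⟩ := ih hin.le
    set S := solution f (indepOracle Ms) c tie stream ω i with hS
    set u := stream ⟨i, hin⟩ with hu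
    have hsol : solution f (indepOracle Ms) c tie stream ω (i + 1) =
        (arrive f (indepOracle Ms) c tie (ω ⟨i, hin⟩) S u).mem.S := by
      rw [solution, dif_pos hin]
    have hP : arrived stream (i + 1) = insert u (arrived stream i) := by
      ext x
      simp only [arrived, Finset.mem_filter, Finset.mem_univ, true_and, Finset.mem_insert]
      rw [hu, ← Equiv.symm_apply_eq, Fin.ext_iff]
      change _ ↔ (stream.symm x : ℕ) = i ∨ _
      omega
    have huP : u ∉ arrived stream i := by simp [arrived, hu]
    have hg : arrivalGain f Ms c tie stream ω u = f (insert u S.toFinset) - f S.toFinset := by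
      simp [arrivalGain, hu, hS]
    have huA : u ∉ A := fun h' => huP (h.accepted_subset h')
    have huR : u ∉ R := fun h' => huP (h.rejected_subset h')
    have hlt : ∀ j : Fin n, (j : ℕ) < i + 1 → (j : ℕ) < i ∨ j = ⟨i, hin⟩ := fun j hj => by
      rw [Fin.ext_iff]
      simp only
      omega
    have hne : ∀ j : Fin n, (j : ℕ) < i → stream j ≠ u := fun j hj h' => by
      rw [hu, stream.injective.eq_iff, Fin.ext_iff] at h'
      simp only at h'
      omega
    rw [hsol, hP]
    by_cases hacc : Accepts f Ms c tie S u
    · by_cases hω : ω ⟨i, hin⟩ = true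
      · obtain ⟨leaf', v', w', h'⟩ := h.accept hf hc hg huP
          (isChoice_choices f Ms c tie S u) hacc.1 hacc.2
        rw [hω, arrive_of_accepts f Ms c tie hacc]
        refine ⟨_, _, leaf', v', w', h', fun j hj => ?_⟩
        rcases hlt j hj with hj | rfl
        · simpa [hne j hj] using hAR j hj
        · simp [← hu, ← hS, hω, hacc, huR]
      · rw [Bool.not_eq_true] at hω
        rw [hω]
        refine ⟨_, _, leaf, v, w, h.skip hf hg, fun j hj => ?_⟩
        rcases hlt j hj with hj | rfl
        · exact hAR j hj
        · simp [← hu, ← hS, hω, hacc, huA, huR]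
    · obtain ⟨w', h'⟩ := h.reject hf hc hg huP (isChoice_choices f Ms c tie S u) hacc
      rw [arrive_of_not_accepts f Ms c tie _ hacc]
      refine ⟨_, _, leaf, v, w', h', fun j hj => ?_⟩
      rcases hlt j hj with hj | rfl
      · simpa [hne j hj] using hAR j hj
      · simp [← hu, ← hS, hacc, huA]

-- The gain terms over `OPT ∩ A` and `OPT \ (A ∪ R)` become sums over times with the same summand,
-- separated only by the outcome of the coin.
open Classical in
variable {f} {c} in
lemma exists_accepted [Fintype N] (hf : Submodular f) (hc : 0 < c) {p : ℕ} (hp1 : 1 ≤ p)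
    (hp : IsMatchoid p Ms) {OPT : Finset N} (hO : Feasible Ms OPT) (ω : Fin n → Bool) :
    ∃ A : Finset N, (∀ j, stream j ∈ A → ω j = true) ∧
      f (OPT ∪ A) + (1 + c) * p * ∑ j, (if ω j then
          if stream j ∈ OPT ∧ Accepts f Ms c tie
            (solution f (indepOracle Ms) c tie stream ω j) (stream j)
          then arrivalGain f Ms c tie stream ω (stream j) else 0 else 0) ≤
        f ∅ + (1 + c) ^ 2 * p / c * (f (output f Ms c tie stream ω) - f ∅) +
          ∑ j, (if ω j then 0 else
            if stream j ∈ OPT ∧ Accepts f Ms c tie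
              (solution f (indepOracle Ms) c tie stream ω j) (stream j)
            then arrivalGain f Ms c tie stream ω (stream j) else 0) := by
  obtain ⟨A, R, leaf, v, w, h, hAR⟩ := exists_runInvariant Ms tie stream hf hc ω n le_rfl
  have h1 := h.union_le hf hc hp1 hp hO fun x _ => by simp [arrived]
  have hsum : ∀ B : Finset N, ∑ x ∈ B, arrivalGain f Ms c tie stream ω x =
      ∑ j, if stream j ∈ B then arrivalGain f Ms c tie stream ω (stream j) else 0 := by
    intro B
    rw [Equiv.sum_comp stream fun x => if x ∈ B then arrivalGain f Ms c tie stream ω x else 0]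
    simp
  refine ⟨A, fun j hj => ((hAR j j.2).1.1 hj).1, ?_⟩
  rw [hsum, hsum] at h1
  have h2 : ∀ j, (stream j ∈ OPT ∩ A) ↔ ω j = true ∧ (stream j ∈ OPT ∧ Accepts f Ms c tie
      (solution f (indepOracle Ms) c tie stream ω j) (stream j)) := fun j => by
    rw [Finset.mem_inter, (hAR j j.2).1]
    tauto
  have h3 : ∀ j, stream j ∈ OPT \ (A ∪ R) ↔ ¬ (ω j = true) ∧ (stream j ∈ OPT ∧ Accepts f Ms c tie
      (solution f (indepOracle Ms) c tie stream ω j) (stream j)) := fun j => by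
    rw [Finset.mem_sdiff, Finset.mem_union, (hAR j j.2).1, (hAR j j.2).2]
    tauto
  simpa only [h2, h3, ite_and, ite_not, output] using h1

variable {c} in
lemma samplingProb_nonneg (hc : 0 < c) (p : ℕ) : 0 ≤ samplingProb c p := by
  unfold samplingProb
  positivity

variable {c} in
lemma samplingProb_le_one (hc : 0 < c) (p : ℕ) : samplingProb c p ≤ 1 := by
  unfold samplingProb
  refine inv_le_one_of_one_le₀ ?_
  have : 0 ≤ (1 + c) * (p : ℝ) := by positivity
  linarith

variable {f} {c} in
/-- There is a random set of sampled elements, namely the set of all elements that are accepted,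
whose union with `OPT` is paid for by the output. -/
lemma exists_expectation_union_le [Fintype N] (hf : Submodular f) (hf0 : ∀ A, 0 ≤ f A)
    (hc : 0 < c) {p : ℕ} (hp1 : 1 ≤ p) (hp : IsMatchoid p Ms) {OPT : Finset N}
    (hO : Feasible Ms OPT) :
    ∃ A : (Fin n → Bool) → Finset N, (∀ ω j, stream j ∈ A ω → ω j = true) ∧
      expectation (samplingProb c p) (fun ω => f (OPT ∪ A ω)) ≤
        (1 + c) ^ 2 * p / c *
          expectation (samplingProb c p) (fun ω => f (output f Ms c tie stream ω)) := by
  classical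
  choose A hA hle using exists_accepted Ms tie stream hf hc hp1 hp hO
  refine ⟨A, hA, ?_⟩
  set q := samplingProb c p with hq
  have hpc : 0 < (1 + c) * (p : ℝ) := by
    have : (1 : ℝ) ≤ p := by exact_mod_cast hp1
    positivity
  have hq0 : 0 < q := by
    rw [hq, samplingProb]
    positivity
  have hq1 : q ≤ 1 := samplingProb_le_one hc p
  have hK : 1 ≤ (1 + c) ^ 2 * (p : ℝ) / c := by
    have : (1 : ℝ) ≤ p := by exact_mod_cast hp1
    rw [le_div_iff₀ hc]
    nlinarith
  set G : Fin n → (Fin n → Bool) → ℝ := fun j ω =>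
    if stream j ∈ OPT ∧ Accepts f Ms c tie
      (solution f (indepOracle Ms) c tie stream ω j) (stream j)
    then arrivalGain f Ms c tie stream ω (stream j) else 0 with hG
  have hGupd : ∀ j ω b, G j (Function.update ω j b) = G j ω := by
    intro j ω b
    simp only [hG, arrivalGain, Equiv.symm_apply_apply, solution_update ω j b j le_rfl]
  -- This is where `q` is used: `1 - q = (1 + c) p q`.
  have htoss : ∀ j, expectation q (fun ω => if ω j then 0 else G j ω) =
      (1 + c) * p * expectation q (fun ω => if ω j then G j ω else 0) := by
    intro j
    refine mul_left_cancel₀ hq0.ne' ?_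
    rw [expectation_toss j (G j) (hGupd j), ← mul_assoc]
    congr 1
    rw [hq, samplingProb]
    field_simp
    ring
  have hmono := expectation_mono hq0.le hq1 hle
  rw [expectation_add, expectation_add, expectation_mul_left, expectation_sum, expectation_sum,
    Finset.sum_congr rfl fun j _ => htoss j, ← Finset.mul_sum] at hmono
  have hmono' := le_of_add_le_add_right hmono
  refine hmono'.trans ?_
  rw [← expectation_mul_left]
  refine expectation_mono hq0.le hq1 fun ω => ?_
  -- The factor `(1 + c)² p / c` is at least `1`, so `f ∅` occurs with a nonpositive total
  -- coefficient and can be dropped.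
  nlinarith [hf0 ∅]

end Algorithm

/-! ### Guarantees -/

section Guarantees

variable {N : Type u} [Fintype N] [DecidableEq N] {n m : ℕ} {f : Finset N → ℝ}
  {Ms : Fin m → Matroid N} {c : ℝ} (tie : TieRule N m) (stream : Fin n ≃ N)

omit [DecidableEq N] in
lemma Feasible.card_le_matchoidRank {T : Finset N} (h : Feasible Ms T) :
    T.card ≤ matchoidRank Ms := by
  classical
  exact Finset.le_sup (f := Finset.card) (by simpa using h)

lemma feasible_solution (hf : Submodular f) (hc : 0 < c) (ω : Fin n → Bool) {i : ℕ} (hi : i ≤ n) :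
    Feasible Ms (solution f (indepOracle Ms) c tie stream ω i).toFinset := by
  obtain ⟨A, R, leaf, v, w, h, -⟩ := exists_runInvariant Ms tie stream hf hc ω i hi
  exact h.feasible

lemma length_solution_le (hf : Submodular f) (hc : 0 < c) (ω : Fin n → Bool) {i : ℕ}
    (hi : i ≤ n) :
    (solution f (indepOracle Ms) c tie stream ω i).length ≤ matchoidRank Ms := by
  obtain ⟨A, R, leaf, v, w, h, -⟩ := exists_runInvariant Ms tie stream hf hc ω i hi
  rw [← List.toFinset_card_of_nodup h.nodup]
  exact h.feasible.card_le_matchoidRank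

lemma peak_arrivalOutcome_le (hf : Submodular f) (hc : 0 < c) (ω : Fin n → Bool) (i : Fin n) :
    (arrivalOutcome f Ms c tie stream ω i).peak ≤ 5 * matchoidRank Ms + 11 := by
  have h1 := length_solution_le (Ms := Ms) tie stream hf hc ω i.2.le
  unfold arrivalOutcome arrive
  split_ifs
  · have h2 := (exec_considerElement (f := f) (I := indepOracle Ms) c tie
      (solution f (indepOracle Ms) c tie stream ω i) (stream i)).2.2
    omega
  · simp only [Outcome.idle, initialMemory, Memory.size, List.length_nil]
    omega

lemma queries_arrivalOutcome_le (hf : Submodular f) (hc : 0 < c) (ω : Fin n → Bool)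
    (i : Fin n) : (arrivalOutcome f Ms c tie stream ω i).queries ≤
      if ω i then m * (3 * matchoidRank Ms + 1) + 2 * matchoidRank Ms + 2 else 0 := by
  have h1 := length_solution_le (Ms := Ms) tie stream hf hc ω i.2.le
  unfold arrivalOutcome arrive
  split_ifs
  · refine (exec_considerElement (f := f) (I := indepOracle Ms) c tie
      (solution f (indepOracle Ms) c tie stream ω i) (stream i)).2.1.trans ?_
    gcongr
  · exact le_rfl

lemma expectation_queries_le (hf : Submodular f) (hc : 0 < c) {p : ℕ} (hp : 1 ≤ p)
    (hk : 1 ≤ matchoidRank Ms) (hm : 1 ≤ m) (i : Fin n) :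
    expectation (samplingProb c p)
      (fun ω => ((arrivalOutcome f Ms c tie stream ω i).queries : ℝ)) ≤
      8 * (matchoidRank Ms * m / p) := by
  have hq0 := samplingProb_nonneg hc p
  have hq1 := samplingProb_le_one hc p
  have hp' : (1 : ℝ) ≤ p := by exact_mod_cast hp
  have hqp : samplingProb c p ≤ 1 / p := by
    rw [samplingProb, one_div]
    refine inv_anti₀ (by positivity) ?_
    nlinarith
  -- With `k, m ≥ 1`, each of `m`, `k` and `1` is at most `k m`, and `3 + 1 + 2 + 2 = 8`.
  have hB : m * (3 * matchoidRank Ms + 1) + 2 * matchoidRank Ms + 2 ≤ 8 * (matchoidRank Ms * m) := by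
    nlinarith
  calc expectation (samplingProb c p)
        (fun ω => ((arrivalOutcome f Ms c tie stream ω i).queries : ℝ))
      ≤ expectation (samplingProb c p) (fun ω => (8 * (matchoidRank Ms * m : ℝ)) *
          if ω i then 1 else 0) := by
        refine expectation_mono hq0 hq1 fun ω => ?_
        have h1 := queries_arrivalOutcome_le (Ms := Ms) tie stream hf hc ω i
        split_ifs at h1 ⊢
        · rw [mul_one]
          exact_mod_cast h1.trans hB
        · simpa using h1
    _ = 8 * (matchoidRank Ms * m : ℝ) * samplingProb c p := by
        rw [expectation_mul_left, expectation_toss_true]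
    _ ≤ 8 * (matchoidRank Ms * m : ℝ) * (1 / p) := by gcongr
    _ = 8 * (matchoidRank Ms * m / p) := by ring

omit [Fintype N] in
lemma Submodular.union_left (hf : Submodular f) (T : Finset N) :
    Submodular fun A => f (T ∪ A) := by
  intro A B
  have := hf (T ∪ A) (T ∪ B)
  rwa [← Finset.union_union_distrib_left, ← Finset.union_inter_distrib_left] at this

lemma expectation_output_of_monotone (hf : Submodular f) (hf0 : ∀ A, 0 ≤ f A) (hmono : Monotone f)
    (hc : 0 < c) {p : ℕ} (hp1 : 1 ≤ p) (hp : IsMatchoid p Ms) {OPT : Finset N}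
    (hO : Feasible Ms OPT) :
    f OPT ≤ (1 + c) ^ 2 * p / c *
      expectation (samplingProb c p) (fun ω => f (output f Ms c tie stream ω)) := by
  obtain ⟨A, -, hA⟩ := exists_expectation_union_le Ms tie stream hf hf0 hc hp1 hp hO
  refine le_trans ?_ hA
  rw [← expectation_const (n := n) (samplingProb c p) (f OPT)]
  exact expectation_mono (samplingProb_nonneg hc p) (samplingProb_le_one hc p)
    fun ω => hmono Finset.subset_union_left

/-- Only sampled elements enter `A`, so each does so with probability at most `q`; the sampling
lemma is applied to the submodular function `A ↦ f (OPT ∪ A)`. -/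
lemma expectation_output (hf : Submodular f) (hf0 : ∀ A, 0 ≤ f A)
    (hc : 0 < c) {p : ℕ} (hp1 : 1 ≤ p) (hp : IsMatchoid p Ms) {OPT : Finset N}
    (hO : Feasible Ms OPT) :
    (1 - samplingProb c p) * f OPT ≤ (1 + c) ^ 2 * p / c *
      expectation (samplingProb c p) (fun ω => f (output f Ms c tie stream ω)) := by
  obtain ⟨A, hAω, hA⟩ := exists_expectation_union_le Ms tie stream hf hf0 hc hp1 hp hO
  have hq0 := samplingProb_nonneg hc p
  have hq1 := samplingProb_le_one hc p
  refine le_trans ?_ hA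
  have h := (hf.union_left OPT).le_expectation (fun _ => hf0 _) hq0 hq1 A fun x => ?_
  · simpa using h
  · refine le_trans (expectation_mono hq0 hq1 fun ω => ?_)
      (expectation_toss_true (q := samplingProb c p) (stream.symm x)).le
    by_cases hx : x ∈ A ω
    · rw [if_pos hx, if_pos (hAω ω _ (by simpa using hx))]
    · rw [if_neg hx]
      split_ifs <;> norm_num

/-- The approximation ratio for the choice `c = √(1 + 1/p)`. -/
lemma ratio_eq {p : ℕ} (hp : 1 ≤ p) :
    (1 - samplingProb √(1 + 1 / (p : ℝ)) p) * (2 * p + 2 * √((p : ℝ) * (p + 1)) + 1) =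
      (1 + √(1 + 1 / (p : ℝ))) ^ 2 * p / √(1 + 1 / (p : ℝ)) := by
  have hp' : (0 : ℝ) < p := by exact_mod_cast hp
  set c := √(1 + 1 / (p : ℝ)) with hc
  have hc0 : 0 < c := Real.sqrt_pos.2 (by positivity)
  -- This relation turns `√(p (p + 1))` into `c p` and reduces the claim to a polynomial identity.
  have hsq : c ^ 2 * p = p + 1 := by
    rw [hc, Real.sq_sqrt (by positivity)]
    field_simp
  have hs : √((p : ℝ) * (p + 1)) = c * p := by
    rw [← hsq, show (p : ℝ) * (c ^ 2 * p) = (c * p) ^ 2 by ring, Real.sqrt_sq (by positivity)]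
  rw [hs, samplingProb]
  have hne : (1 + c) * (p : ℝ) + 1 ≠ 0 := by positivity
  field_simp
  linear_combination ((1 + c) * (p : ℝ)) * hsq

end Guarantees

end

end SampleStreaming

/-! ### The main theorem. -/

open SampleStreaming in
theorem mainTheorem1 :
    ∃ C : ℝ, 0 < C ∧
      ∀ (N : Type u) [Fintype N] [DecidableEq N] (n m p : ℕ) (stream : Fin n ≃ N)
        (Ms : Fin m → Matroid N) (tie : TieRule N m) (f : Finset N → ℝ),
        1 ≤ p → IsMatchoid p Ms → (∀ A : Finset N, 0 ≤ f A) → Submodular f →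
        -- the approximation guarantee for monotone functions, with `c = 1`
        (Monotone f → ∀ OPT : Finset N, IsOptimal f Ms OPT →
          f OPT / (4 * p) ≤
            expectation (samplingProb 1 p) (fun ω => f (output f Ms 1 tie stream ω))) ∧
        -- the approximation guarantee for general functions, with `c = √(1 + 1/p)`
        (∀ OPT : Finset N, IsOptimal f Ms OPT →
          f OPT / (2 * p + 2 * √((p : ℝ) * (p + 1)) + 1) ≤
            expectation (samplingProb (√(1 + 1 / (p : ℝ))) p)
              (fun ω => f (output f Ms (√(1 + 1 / (p : ℝ))) tie stream ω))) ∧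
        -- feasibility, memory and expected number of oracle queries, for every `c > 0`
        (∀ c : ℝ, 0 < c →
          (∀ ω : Fin n → Bool, Feasible Ms (output f Ms c tie stream ω)) ∧
          (1 ≤ matchoidRank Ms → ∀ (ω : Fin n → Bool) (i : Fin n),
            ((arrivalOutcome f Ms c tie stream ω i).peak : ℝ) ≤ C * matchoidRank Ms) ∧
          (1 ≤ matchoidRank Ms → 1 ≤ m → ∀ i : Fin n,
            expectation (samplingProb c p)
                (fun ω => ((arrivalOutcome f Ms c tie stream ω i).queries : ℝ)) ≤
              C * (matchoidRank Ms * m / p))) := by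
  -- The memory bound dictates the constant: `5 k + 11 ≤ 16 k` for `k ≥ 1`. The queries need only
  -- `8`.
  refine ⟨16, by norm_num, ?_⟩
  intro N _ _ n m p stream Ms tie f hp hM hf0 hf
  have hp' : (1 : ℝ) ≤ p := by exact_mod_cast hp
  refine ⟨fun hmono OPT hO => ?_, fun OPT hO => ?_, fun c hc => ⟨fun ω => ?_, fun hk ω i => ?_,
    fun hk hm i => ?_⟩⟩
  · have h := expectation_output_of_monotone tie stream hf hf0 hmono one_pos hp hM hO.1
    rw [div_le_iff₀' (by positivity)]
    refine h.trans_eq ?_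
    norm_num
  · have hc : 0 < √(1 + 1 / (p : ℝ)) := Real.sqrt_pos.2 (by positivity)
    have h := expectation_output tie stream hf hf0 hc hp hM hO.1
    have hq : 0 < 1 - samplingProb √(1 + 1 / (p : ℝ)) p := by
      rw [sub_pos, samplingProb]
      refine inv_lt_one_of_one_lt₀ ?_
      have : 0 < (1 + √(1 + 1 / (p : ℝ))) * (p : ℝ) := by positivity
      linarith
    rw [← ratio_eq hp, mul_assoc] at h
    rw [div_le_iff₀' (by positivity)]
    exact le_of_mul_le_mul_left h hq
  · exact feasible_solution tie stream hf hc ω le_rfl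
  · have h : (arrivalOutcome f Ms c tie stream ω i).peak ≤ 16 * matchoidRank Ms :=
      (peak_arrivalOutcome_le tie stream hf hc ω i).trans (by omega)
    exact_mod_cast h
  · refine (expectation_queries_le tie stream hf hc hp hk hm i).trans ?_
    have : (0 : ℝ) ≤ matchoidRank Ms * m / p := by positivity
    linarith
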